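/- Let $V$ be a complex vector space of finite dimension $N$, and let $d,k$ be integers with $d\ge 2$ and $1\le k<N$. Let $T_k$ be the tautological subbundle of the Grassmannian $\mathrm{Gr}_k(V^\vee)$ of $k$-dimensional linear subspaces of $V^\vee$, let $$S^dT_k=\{(U,q)\mid U\in \mathrm{Gr}_k(V^\vee),\ q\in S^dU\}\subset \mathrm{Gr}_k(V^\vee)\times S^dV^\vee$$ be the total space of its $d$-th symmetric power, let $C(S^dT_k)\subset S^dV^\vee$ be the image of the projection $(U,q)\mapsto q$ with its reduced structure, and let $\rho:S^dT_k\to C(S^dT_k)$ be the induced morphism (the Kempf collapsing). Let $\mathrm{Exc}(\rho)\subset C(S^dT_k)$ be the exceptional locus of $\rho$, i.e. the complement of the largest open subset of $C(S^dT_k)$ over which $\rho$ is an isomorphism. For $q\in S^dV^\vee$ let $L_q$ be the intersection of all linear subspaces $L\subset V^\vee$ with $q\in S^dL$, and put $\mathrm{rk}(q)=\dim L_q$. Let $S^dV^\vee_{\le r}$ and $S^dV^\vee_{r}$ be the sets of all $q\in S^dV^\vee$ with $\mathrm{rk}(q)\le r$ and $\mathrm{rk}(q)=r$, respectively. Then $C(S^dT_k)=S^dV^\vee_{\le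 k}$ (the catalecticant variety), and: 1. $\mathrm{Exc}(\rho)=S^dV^\vee_{\le k-1}$. 2. For $0\le r\le k$ one has $$\dim \rho^{-1}(S^dV^\vee_r)=\binom{r+d-1}{d}+r(N-r)+(k-r)(N-k),$$ $$\mathrm{codim}_{S^dT_k}\,\rho^{-1}(S^dV^\vee_r)=\binom{k+d-1}{d}-\binom{r+d-1}{d}-r(k-r).$$ 3. One has $$\mathrm{codim}_{S^dT_k}\,\rho^{-1}(\mathrm{Exc}(\rho))=\min_{0\le r<k}\left\{\binom{k+d-1}{d}-\binom{r+d-1}{d}-r(k-r)\right\}.$$ -/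

import Mathlib

noncomputable section

namespace Kempf

open Module

/-! ## Classical complex varieties as spaces with functions -/

/-- A space with functions: a topological space together with a notion of regularity at a point
for complex-valued functions. A function is regular on an open set if it is regular at each point
of it. -/
class SpaceWithFunctions (X : Type*) extends TopologicalSpace X where
  /-- `RegularAt f x`: the function `f` is regular on some open neighbourhood of `x`. -/
  RegularAt : (X → ℂ) → X → Prop

/-- The polynomial functions on a complex vector space: the algebra of functions generated by
the linear functionals. -/
def polyFun (A : Type*) [AddCommGroup A] [Module ℂ A] : Subalgebra ℂ (A → ℂ) :=
  Algebra.adjoin ℂ (Set.range fun l : Dual ℂ A => (l : A → ℂ))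

/-- The common zero locus of a set of polynomial functions. -/
def zeroLocus {A : Type*} [AddCommGroup A] [Module ℂ A] (T : Set (polyFun A)) : Set A :=
  {x | ∀ p ∈ T, (p : A → ℂ) x = 0}

/-- The Zariski topology on a complex vector space: the closed sets are the common zero loci of
sets of polynomial functions. -/
@[reducible] def zariski (A : Type*) [AddCommGroup A] [Module ℂ A] : TopologicalSpace A :=
  TopologicalSpace.ofClosed {Z | ∃ T : Set (polyFun A), Z = zeroLocus T}
    ⟨{1}, by ext x; simp [zeroLocus]⟩
    (by
      intro C hC
      refine ⟨{p | ∀ x ∈ ⋂₀ C, (p : A → ℂ) x = 0}, ?_⟩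
      ext x
      refine ⟨fun hx p hp => hp x hx, fun hx Z hZ => ?_⟩
      obtain ⟨T, rfl⟩ := hC hZ
      exact fun p hp => hx p fun y hy => hy _ hZ p hp)
    (by
      rintro _ ⟨S, rfl⟩ _ ⟨T, rfl⟩
      refine ⟨{p | ∃ s ∈ S, ∃ t ∈ T, p = s * t}, ?_⟩
      ext x
      constructor
      · rintro (hx | hx) p ⟨s, hs, t, ht, rfl⟩
        · simp [hx s hs]
        · simp [hx t ht]
      · intro hx
        by_contra hcon
        simp only [Set.mem_union, not_or, zeroLocus, Set.mem_ofPred_eq, not_forall] at hcon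
        obtain ⟨⟨s, hs, hsx⟩, t, ht, htx⟩ := hcon
        have h := hx (s * t) ⟨s, hs, t, ht, rfl⟩
        simp only [MulMemClass.coe_mul, Pi.mul_apply, mul_eq_zero] at h
        tauto)

/-- The reduced structure on a subset `X` of a complex vector space `A`: the induced Zariski
topology, and the functions that are locally quotients of polynomial functions. -/
@[reducible] def subsetStructure {A : Type*} [AddCommGroup A] [Module ℂ A] (X : Set A) :
    SpaceWithFunctions X where
  toTopologicalSpace := (zariski A).induced Subtype.val
  RegularAt f x := ∃ O : Set X, @IsOpen X ((zariski A).induced Subtype.val) O ∧ x ∈ O ∧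
    ∃ p s : polyFun A, ∀ y ∈ O, (s : A → ℂ) y ≠ 0 ∧ f y = (p : A → ℂ) y / (s : A → ℂ) y

/-- The map `f : X → Y` restricts to an isomorphism `f ⁻¹' O → O` of spaces with functions: the
restriction is a homeomorphism, and regular functions correspond to each other. -/
def IsIsoOver {X Y : Type*} [SpaceWithFunctions X] [SpaceWithFunctions Y] (f : X → Y)
    (O : Set Y) : Prop :=
  IsHomeomorph (O.restrictPreimage f) ∧
    ∀ (g : Y → ℂ) (x : X), f x ∈ O →
      (SpaceWithFunctions.RegularAt g (f x) ↔ SpaceWithFunctions.RegularAt (g ∘ f) x)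

/-- The exceptional locus of `f : X → Y`: the complement in `Y` of the largest open subset over
which `f` is an isomorphism. -/
def Exc {X Y : Type*} [SpaceWithFunctions X] [SpaceWithFunctions Y] (f : X → Y) : Set Y :=
  (⋃₀ {O : Set Y | IsOpen O ∧ IsIsoOver f O})ᶜ

/-- The codimension of a subset `Z` of `X`: the least codimension in `X` of an irreducible closed
subset of the closure of `Z`, where the codimension of an irreducible closed `Y` is the supremum
of the lengths `n` of chains `Y = Y₀ ⊂ Y₁ ⊂ ⋯ ⊂ Yₙ` of irreducible closed subsets of `X`. -/
def codim {X : Type*} [TopologicalSpace X] (Z : Set X) : ℕ∞ :=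
  ⨅ (Y : TopologicalSpace.IrreducibleCloseds X) (_ : (Y : Set X) ⊆ closure Z), Order.coheight Y

/-! ## Symmetric powers and the rank of a symmetric tensor -/

section

variable (W : Type*) [AddCommGroup W] [Module ℂ W]

/-- The symmetric power `S^d W`: the span, in the symmetric algebra of `W`, of the products of
`d` elements of `W`. -/
def symPow (d : ℕ) : Submodule ℂ (SymmetricAlgebra ℂ W) :=
  LinearMap.range (SymmetricAlgebra.ι ℂ W) ^ d

variable {W}

/-- The subspace `S^d L` of `S^d W` for a linear subspace `L` of `W`: the span of the products of
`d` elements of `L`. -/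
def symPowOf (d : ℕ) (L : Submodule ℂ W) : Submodule ℂ (symPow W d) :=
  (L.map (SymmetricAlgebra.ι ℂ W) ^ d).comap (symPow W d).subtype

/-- The intersection `L_q` of all linear subspaces `L` of `W` with `q ∈ S^d L`. -/
def minSubspace {d : ℕ} (q : symPow W d) : Submodule ℂ W :=
  sInf {L : Submodule ℂ W | q ∈ symPowOf d L}

/-- The rank of `q ∈ S^d W` is the dimension of `L_q`. -/
def rk {d : ℕ} (q : symPow W d) : ℕ := finrank ℂ (minSubspace q)

end

/-! ## The bundle `S^d T_k` over the Grassmannian and its Kempf collapsing -/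

section

variable (W : Type*) [AddCommGroup W] [Module ℂ W] (d k : ℕ)

/-- The total space of `S^d T_k`, where `T_k` is the tautological subbundle of the Grassmannian
`Gr_k(W)` of `k`-dimensional linear subspaces of `W`: the pairs `(U, q)` with `U ∈ Gr_k(W)` and
`q ∈ S^d U`. -/
@[ext] structure SymTaut where
  /-- The point `U` of the Grassmannian. -/
  space : Submodule ℂ W
  /-- The subspace `U` has dimension `k`. -/
  finrank_space : finrank ℂ space = k
  /-- The point `q` of the fibre `S^d U`. -/
  tensor : symPow W d
  /-- The point `q` lies in the fibre over `U`. -/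
  tensor_mem : tensor ∈ symPowOf d space

/-- The pairs `(w, q)` where `w` is a basis of a `k`-dimensional subspace `U` of `W` and
`q ∈ S^d U`. This is the restriction to `S^d T_k` of the principal `GL_k`-bundle of frames. -/
def framed : Set ((Fin k → W) × symPow W d) :=
  {p | LinearIndependent ℂ p.1 ∧ p.2 ∈ symPowOf d (Submodule.span ℂ (Set.range p.1))}

instance : SpaceWithFunctions (framed W d k) := subsetStructure _

variable {W d k} in
/-- The quotient map by `GL_k`, which sends `(w, q)` to `(span w, q)`. -/
def forgetFrame (p : framed W d k) : SymTaut W d k where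
  space := Submodule.span ℂ (Set.range p.1.1)
  finrank_space := by simpa using finrank_span_eq_card p.2.1
  tensor := p.1.2
  tensor_mem := p.2.2

/-- The structure of a variety on `S^d T_k` (with `Gr_k(W)` the geometric quotient by `GL_k` of the
space of `k`-frames): the quotient topology of the Zariski topology, and the functions which
become regular after pull-back to the space of frames. -/
instance : SpaceWithFunctions (SymTaut W d k) where
  toTopologicalSpace := TopologicalSpace.coinduced (forgetFrame (W := W) (d := d) (k := k))
    inferInstance
  RegularAt f x := ∀ p : framed W d k, forgetFrame p = x →
    SpaceWithFunctions.RegularAt (f ∘ forgetFrame) p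

/-- The cone `C(S^d T_k)`: the image in `S^d W` of the projection `(U, q) ↦ q`. -/
def cone : Set (symPow W d) := Set.range fun x : SymTaut W d k => x.tensor

instance : SpaceWithFunctions (cone W d k) := subsetStructure _

/-- The Kempf collapsing `ρ : S^d T_k → C(S^d T_k)`, `(U, q) ↦ q`. -/
def collapsing (x : SymTaut W d k) : cone W d k := ⟨x.tensor, x, rfl⟩

end

end Kempf

end

/-! Write `W` for the dual of `V`, with `N = dim W`. Contraction `v ↦ ∂_v q` controls everything. In
characteristic zero `q ∈ S^d U` exactly when `∂_v q = 0` for all `v` annihilating `U`, so `L_q` is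
the subspace cut out by the kernel of the contraction, and `rk q` is the rank of the contraction
(`mem_symPowOf_iff`, `rk_eq`). The fibre of the collapsing over `q` is therefore the set of
`k`-dimensional `U` containing `L_q`. It is a single point if `rk q = k`, and has at least two
points if `rk q < k < N` (`exists_ne_of_rk_lt`). Over rank `k` the inverse is regular: composing the
contraction with suitable functionals gives `k` vectors, linear in `q`, that form a frame of `L_q`
near a given tensor (`isIsoOver_rk_eq`). This determines the exceptional locus.

A point of the stratum of rank `r` is a flag `L ⊂ U` together with a tensor of full rank in `S^d L`,
which explains the dimension `k(N-k) + r(k-r) + dim S^d L`. To obtain dimension and codimension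
together, the stratum is straightened locally. In a basis adapted to `L_q ⊂ U ⊂ W`, every nearby
point comes from a unique triple: a unipotent map moving `U` to a graph, a unipotent map inside `U`
moving `L_q`, and a tensor in a linear slice of `S^d U`. On the slice, rank `r` is the linear
condition of lying in `S^d L_q` (`rk_chartTensor_eq_iff`). So near each of its points the stratum is
a linear subspace of a vector space (`hasLinearChart_rk_eq`), where dimensions are known.

Each stratum is irreducible, being the image of a nonempty open subset of a vector space
(`isIrreducible_rk_eq`), so one chart gives its codimension. The preimage of the exceptional locus
is the finite union of the strata with `r < k`, and codimension turns a finite union into a minimum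
(`codim_iUnion`). -/

noncomputable section

namespace Kempf

open Module Topology TopologicalSpace

universe u

section

attribute [local instance] zariski

/-! ### The Zariski topology of a vector space: irreducibility and dimension. -/

section Zariski

variable {E : Type*} [AddCommGroup E] [Module ℂ E]

theorem isClosed_zariski_iff {Z : Set E} :
    IsClosed Z ↔ ∃ T : Set (polyFun E), Z = zeroLocus T := by
  rw [← isOpen_compl_iff]
  change Zᶜᶜ ∈ _ ↔ _
  rw [compl_compl]
  rfl

theorem linear_mem_polyFun (l : Dual ℂ E) : (l : E → ℂ) ∈ polyFun E :=
  Algebra.subset_adjoin ⟨l, rfl⟩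

theorem isClosed_zero_polyFun {p : E → ℂ} (hp : p ∈ polyFun E) : IsClosed {x | p x = 0} :=
  isClosed_zariski_iff.2 ⟨{⟨p, hp⟩}, by ext; simp [zeroLocus]⟩

theorem isOpen_ne_polyFun {p : E → ℂ} (hp : p ∈ polyFun E) : IsOpen {x | p x ≠ 0} :=
  (isClosed_zero_polyFun hp).isOpen_compl

theorem exists_polyFun_of_isOpen {O : Set E} (hO : IsOpen O) {x : E} (hx : x ∈ O) :
    ∃ p ∈ polyFun E, p x ≠ 0 ∧ ∀ y, p y ≠ 0 → y ∈ O := by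
  obtain ⟨T, hT⟩ := isClosed_zariski_iff.1 hO.isClosed_compl
  have hx' : x ∉ zeroLocus T := by rw [← hT]; simpa using hx
  simp only [zeroLocus, Set.mem_ofPred_eq, not_forall] at hx'
  obtain ⟨p, hpT, hp⟩ := hx'
  refine ⟨p, p.2, hp, fun y hy => ?_⟩
  by_contra hyO
  have : y ∈ zeroLocus T := by rw [← hT]; exact hyO
  exact hy (this p hpT)

theorem exists_polynomial_on_line {p : E → ℂ} (hp : p ∈ polyFun E) (x v : E) :
    ∃ P : Polynomial ℂ, ∀ t : ℂ, p (x + t • v) = P.eval t := by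
  induction hp using Algebra.adjoin_induction with
  | mem f hf =>
    obtain ⟨l, rfl⟩ := hf
    exact ⟨Polynomial.C (l x) + Polynomial.C (l v) * Polynomial.X, fun t => by simp [mul_comm t]⟩
  | algebraMap c => exact ⟨Polynomial.C c, by simp⟩
  | add f g _ _ hf hg =>
    obtain ⟨P, hP⟩ := hf
    obtain ⟨Q, hQ⟩ := hg
    exact ⟨P + Q, by simp [hP, hQ]⟩
  | mul f g _ _ hf hg =>
    obtain ⟨P, hP⟩ := hf
    obtain ⟨Q, hQ⟩ := hg
    exact ⟨P * Q, by simp [hP, hQ]⟩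

/-- Join a point of one open set to a point of the other. The polynomials defining basic
neighbourhoods restrict to nonzero polynomials in one variable on this line, and their product has a
non-root. -/
theorem isPreirreducible_of_lines {S : Set E}
    (hS : ∀ x ∈ S, ∀ y ∈ S, ∀ t : ℂ, x + t • (y - x) ∈ S) : IsPreirreducible S := by
  rintro u v hu hv ⟨x, hxS, hxu⟩ ⟨y, hyS, hyv⟩
  obtain ⟨p, hp, hpx, hpu⟩ := exists_polyFun_of_isOpen hu hxu
  obtain ⟨q, hq, hqy, hqv⟩ := exists_polyFun_of_isOpen hv hyv
  obtain ⟨P, hP⟩ := exists_polynomial_on_line hp x (y - x)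
  obtain ⟨Q, hQ⟩ := exists_polynomial_on_line hq x (y - x)
  have hP0 : P ≠ 0 := by
    rintro rfl
    exact hpx (by simpa using hP 0)
  have hQ0 : Q ≠ 0 := by
    rintro rfl
    exact hqy (by simpa using hQ 1)
  obtain ⟨t, ht⟩ : ∃ t, (P * Q).eval t ≠ 0 := by
    by_contra! h
    exact mul_ne_zero hP0 hQ0 (Polynomial.funext (by simpa using h))
  rw [Polynomial.eval_mul, ← hP, ← hQ] at ht
  exact ⟨_, hS x hxS y hyS t, hpu _ (left_ne_zero_of_mul ht), hqv _ (right_ne_zero_of_mul ht)⟩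

/-- The polynomial functions vanishing on a set. -/
def vanishing (S : Set E) : Ideal (polyFun E) where
  carrier := {p | ∀ x ∈ S, (p : E → ℂ) x = 0}
  add_mem' hp hq x hx := by simp [hp x hx, hq x hx]
  zero_mem' := by simp
  smul_mem' c p hp x hx := by simp [hp x hx]

theorem mem_vanishing {S : Set E} {p : polyFun E} :
    p ∈ vanishing S ↔ ∀ x ∈ S, (p : E → ℂ) x = 0 := Iff.rfl

theorem isPrime_vanishing {S : Set E} (hS : IsIrreducible S) : (vanishing S).IsPrime := by
  rw [Ideal.isPrime_iff]
  constructor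
  · intro h
    obtain ⟨x, hx⟩ := hS.nonempty
    have := mem_vanishing.1 ((Ideal.eq_top_iff_one _).1 h) x hx
    simp at this
  · intro p q hpq
    by_contra! h
    simp only [mem_vanishing, not_forall] at h
    obtain ⟨⟨x, hx, hpx⟩, y, hy, hqy⟩ := h
    obtain ⟨z, hz, hz1, hz2⟩ := hS.2 _ _ (isOpen_ne_polyFun p.2) (isOpen_ne_polyFun q.2)
      ⟨x, hx, hpx⟩ ⟨y, hy, hqy⟩
    have := hpq z hz
    simp only [MulMemClass.coe_mul, Pi.mul_apply, mul_eq_zero] at this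
    tauto

theorem subset_of_vanishing_le {S T : Set E} (hT : IsClosed T) (h : vanishing T ≤ vanishing S) :
    S ⊆ T := by
  obtain ⟨P, rfl⟩ := isClosed_zariski_iff.1 hT
  exact fun x hx p hp => mem_vanishing.1 (h (mem_vanishing.2 fun y hy => hy p hp)) x hx

/-- Passing to the vanishing ideal reverses strict inclusions and sends irreducible closed sets to
primes. -/
theorem topologicalKrullDim_zariski_le_ringKrullDim :
    topologicalKrullDim E ≤ ringKrullDim (polyFun E) := by
  rw [ringKrullDim, ← Order.krullDim_orderDual]
  refine Order.krullDim_le_of_strictMono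
    (fun Y => OrderDual.toDual ⟨vanishing (Y : Set E), isPrime_vanishing Y.isIrreducible⟩) ?_
  intro Y Z hYZ
  rw [OrderDual.toDual_lt_toDual]
  refine lt_of_le_not_ge (fun p hp x hx => hp x (hYZ.le hx)) fun h => ?_
  exact hYZ.not_ge (subset_of_vanishing_le Y.isClosed h)

/-- The coordinate functions make `polyFun E` a quotient of a polynomial ring in `dim E` variables;
their algebraic independence plays no role in an upper bound. -/
theorem topologicalKrullDim_zariski_le [FiniteDimensional ℂ E] :
    topologicalKrullDim E ≤ (finrank ℂ E : ℕ∞) := by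
  refine topologicalKrullDim_zariski_le_ringKrullDim.trans ?_
  let b := finBasis ℂ E
  let φ : MvPolynomial (Fin (finrank ℂ E)) ℂ →ₐ[ℂ] polyFun E :=
    MvPolynomial.aeval fun i => ⟨b.coord i, linear_mem_polyFun _⟩
  have hφ : Function.Surjective φ := by
    have hle : polyFun E ≤ ((polyFun E).val.comp φ).range := by
      refine Algebra.adjoin_le ?_
      rintro _ ⟨l, rfl⟩
      have hl : (l : E → ℂ) = ∑ i, l (b i) • (b.coord i : E → ℂ) := by
        ext x
        conv_lhs => rw [← b.sum_repr x, map_sum]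
        simp [mul_comm]
      change (l : E → ℂ) ∈ _
      rw [hl]
      refine Subalgebra.sum_mem _ fun i _ => Subalgebra.smul_mem _ ?_ _
      exact ⟨MvPolynomial.X i, by simp [φ]⟩
    intro p
    obtain ⟨f, hf⟩ := hle p.2
    exact ⟨f, Subtype.ext hf⟩
  refine (ringKrullDim_le_of_surjective φ.toRingHom hφ).trans ?_
  simp [MvPolynomial.ringKrullDim_of_isNoetherianRing]

/-- The translate `e + F` of a linear subspace, as an irreducible closed set. -/
def affineCell (e : E) (F : Submodule ℂ E) : IrreducibleCloseds E where
  carrier := {x | x - e ∈ F}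
  isIrreducible' := by
    refine ⟨⟨e, by simp⟩, isPreirreducible_of_lines fun x hx y hy t => ?_⟩
    have : x + t • (y - x) - e = (x - e) + t • ((y - e) - (x - e)) := by module
    simp only [Set.mem_ofPred_eq] at hx hy ⊢
    rw [this]
    exact F.add_mem hx (F.smul_mem _ (F.sub_mem hy hx))
  isClosed' := by
    have : {x | x - e ∈ F} = ⋂ l ∈ F.dualAnnihilator, {x | (l - algebraMap ℂ (E → ℂ) (l e)) x = 0} := by
      ext x
      simp only [Set.mem_ofPred_eq, Set.mem_iInter, Pi.sub_apply, Pi.algebraMap_apply,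
        Algebra.algebraMap_self, RingHom.id_apply]
      rw [← Subspace.forall_mem_dualAnnihilator_apply_eq_zero_iff]
      simp
    rw [this]
    exact isClosed_biInter fun l _ => isClosed_zero_polyFun
      (Subalgebra.sub_mem _ (linear_mem_polyFun l) (Subalgebra.algebraMap_mem _ _))

@[simp] theorem mem_affineCell {e x : E} {F : Submodule ℂ E} :
    x ∈ affineCell e F ↔ x - e ∈ F := Iff.rfl

@[simp] theorem coe_affineCell_zero (F : Submodule ℂ E) : (affineCell 0 F : Set E) = F := by
  ext x
  simp

theorem affineCell_strictMono (e : E) : StrictMono (affineCell e) := by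
  refine Monotone.strictMono_of_injective (fun F G h x hx => h hx) fun F G h => ?_
  ext x
  have : x + e ∈ affineCell e F ↔ x + e ∈ affineCell e G := by rw [h]
  simpa using this

theorem finrank_quotient_le_coheight_affineCell [FiniteDimensional ℂ E] (e : E)
    (F : Submodule ℂ E) : (finrank ℂ (E ⧸ F) : ℕ∞) ≤ Order.coheight (affineCell e F) := by
  rw [← Module.length_eq_finrank, Module.length_quotient]
  exact Order.coheight_le_coheight_apply_of_strictMono _ (affineCell_strictMono e) F

/-- Chains of linear subspaces bound the height below by `dim F` and the coheight below by `dim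
E/F`. These bounds already add up to `dim E`, which bounds the sum of height and coheight, so no
slack remains. -/
theorem coheight_affineCell [FiniteDimensional ℂ E] (e : E) (F : Submodule ℂ E) :
    Order.coheight (affineCell e F) = finrank ℂ (E ⧸ F) := by
  refine le_antisymm ?_ (finrank_quotient_le_coheight_affineCell e F)
  have h1 : (finrank ℂ F : ℕ∞) ≤ Order.height (affineCell e F) := by
    rw [← Module.length_eq_finrank, Module.length_submodule]
    exact Order.height_le_height_apply_of_strictMono _ (affineCell_strictMono e) F
  have : Nonempty (IrreducibleCloseds E) := ⟨affineCell e F⟩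
  have h2 := topologicalKrullDim_zariski_le (E := E)
  rw [topologicalKrullDim, Order.krullDim_eq_iSup_height_add_coheight_of_nonempty,
    WithBot.coe_le_coe] at h2
  have h3 := (le_iSup (fun Y : IrreducibleCloseds E => Order.height Y + Order.coheight Y)
    (affineCell e F)).trans h2
  rw [← F.finrank_quotient_add_finrank, Nat.cast_add, add_comm] at h3
  refine (ENat.add_le_add_iff_right (k := (finrank ℂ F : ℕ∞)) (ENat.natCast_ne_top _)).1 ?_
  exact (add_le_add_right h1 _).trans h3

/-- The lower bound is the coheight of a point, which does not change on passing to an open subset.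
-/
theorem topologicalKrullDim_isOpenEmbedding_zariski [FiniteDimensional ℂ E] {Y : Type*}
    [TopologicalSpace Y] {j : Y → E} (hj : IsOpenEmbedding j) [Nonempty Y] :
    topologicalKrullDim Y = (finrank ℂ E : ℕ∞) := by
  refine le_antisymm (hj.isInducing.topologicalKrullDim_le.trans topologicalKrullDim_zariski_le) ?_
  obtain ⟨y⟩ := ‹Nonempty Y›
  let V := (IrreducibleCloseds.orderIsoOfIsOpenEmbedding j hj).symm
    ⟨affineCell (j y) ⊥, y, by simp⟩
  have hV : IrreducibleCloseds.map j hj.continuous V = affineCell (j y) ⊥ :=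
    congrArg Subtype.val ((IrreducibleCloseds.orderIsoOfIsOpenEmbedding j hj).apply_symm_apply
      ⟨affineCell (j y) ⊥, y, by simp⟩)
  have := hj.coheight_map V
  rw [hV, coheight_affineCell] at this
  refine le_trans ?_ (Order.coheight_le_krullDim V)
  rw [← this, (Submodule.quotEquivOfEqBot (⊥ : Submodule ℂ E) rfl).finrank_eq]

theorem polyFun_comp_linear {L : Type*} [AddCommGroup L] [Module ℂ L] (i : L →ₗ[ℂ] E)
    {p : E → ℂ} (hp : p ∈ polyFun E) : p ∘ i ∈ polyFun L := by
  induction hp using Algebra.adjoin_induction with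
  | mem f hf =>
    obtain ⟨l, rfl⟩ := hf
    exact linear_mem_polyFun (l ∘ₗ i)
  | algebraMap c => exact Subalgebra.algebraMap_mem _ c
  | add f g _ _ hf hg => exact Subalgebra.add_mem _ hf hg
  | mul f g _ _ hf hg => exact Subalgebra.mul_mem _ hf hg

theorem continuous_zariski_of_linear {L : Type*} [AddCommGroup L] [Module ℂ L]
    (i : L →ₗ[ℂ] E) : Continuous i := by
  refine ⟨fun O hO => ?_⟩
  rw [isOpen_iff_forall_mem_open]
  intro x hx
  obtain ⟨p, hp, hpx, hpO⟩ := exists_polyFun_of_isOpen hO hx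
  exact ⟨_, fun y hy => hpO _ hy, isOpen_ne_polyFun (polyFun_comp_linear i hp), hpx⟩

theorem isEmbedding_zariski {L : Type*} [AddCommGroup L] [Module ℂ L]
    (i : L →ₗ[ℂ] E) (hi : Function.Injective i) : IsEmbedding i := by
  obtain ⟨π, hπ⟩ := i.exists_leftInverse_of_injective (LinearMap.ker_eq_bot.2 hi)
  refine Function.LeftInverse.isEmbedding (f := π) (fun x => ?_)
    (continuous_zariski_of_linear π) (continuous_zariski_of_linear i)
  exact LinearMap.congr_fun hπ x

theorem isOpenEmbedding_of_linear_comp {L Y : Type*} [AddCommGroup L] [Module ℂ L]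
    [TopologicalSpace Y] (i : L →ₗ[ℂ] E) (hi : Function.Injective i) (j : Y → L)
    (hj : IsEmbedding fun y => i (j y)) {O : Set E} (hO : IsOpen O)
    (hr : Set.range j = i ⁻¹' O) : IsOpenEmbedding j := by
  have hemb := isEmbedding_zariski i hi
  exact .mk (hemb.of_comp_iff.1 hj) (hr ▸ hO.preimage hemb.continuous)

end Zariski

/-! ### Dimension and codimension read off from linear charts. -/

section Charts

variable {X : Type*} [TopologicalSpace X]

theorem codim_eq_coheight {Z : Set X} (Y : IrreducibleCloseds X) (hY : (Y : Set X) = closure Z) :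
    codim Z = Order.coheight Y := by
  refine le_antisymm (iInf₂_le Y hY.le) (le_iInf₂ fun Y' h => Order.coheight_anti ?_)
  exact SetLike.coe_subset_coe.1 (h.trans hY.ge)

/-- An irreducible closed set inside a finite union of closures lies in one of them. -/
theorem codim_iUnion {ι : Type*} [Finite ι] (Z : ι → Set X) :
    codim (⋃ i, Z i) = ⨅ i, codim (Z i) := by
  refine le_antisymm (le_iInf fun i => ?_) ?_
  · exact le_iInf₂ fun Y h => iInf₂_le Y (h.trans (closure_mono (Set.subset_iUnion Z i)))
  · refine le_iInf₂ fun Y h => ?_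
    rw [closure_iUnion_of_finite] at h
    obtain ⟨T, hT, hYT⟩ := isIrreducible_iff_sUnion_isClosed.1 Y.isIrreducible
      (Set.finite_range fun i => closure (Z i)).toFinset (by simp) (by simpa using h)
    obtain ⟨i, rfl⟩ := (Set.finite_range fun i => closure (Z i)).mem_toFinset.1 hT
    exact (iInf_le _ i).trans (iInf₂_le Y hYT)

/-- Dimension is the supremum of coheights, and the coheight of `V` can be computed in any open set
meeting `V`. -/
theorem topologicalKrullDim_le_of_charts {X : Type u} [TopologicalSpace X] {n : ℕ∞}
    (h : ∀ x : X, ∃ (Y : Type u) (_ : TopologicalSpace Y) (j : Y → X), IsOpenEmbedding j ∧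
      x ∈ Set.range j ∧ topologicalKrullDim Y ≤ n) :
    topologicalKrullDim X ≤ n := by
  rw [topologicalKrullDim, Order.krullDim_eq_iSup_coheight]
  refine iSup_le fun V => ?_
  obtain ⟨x, hx⟩ := V.isIrreducible.nonempty
  obtain ⟨Y, _, j, hj, ⟨y, rfl⟩, hY⟩ := h x
  let e := IrreducibleCloseds.orderIsoOfIsOpenEmbedding j hj
  let W := e.symm ⟨V, y, hx⟩
  have hW : IrreducibleCloseds.map j hj.continuous W = V :=
    congrArg Subtype.val (e.apply_symm_apply ⟨V, y, hx⟩)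
  rw [← hW, hj.coheight_map]
  exact (Order.coheight_le_krullDim W).trans hY

/-- Around `x`, the subset `Z` of `X` looks like a linear subspace of dimension `e` and
codimension `c` in a vector space with its Zariski topology. -/
def HasLinearChart {X : Type u} [TopologicalSpace X] (Z : Set X) (e c : ℕ) (x : X) : Prop :=
  ∃ (E : Type u) (_ : AddCommGroup E) (_ : Module ℂ E) (_ : FiniteDimensional ℂ E) (O : Set E)
    (ψ : O → X) (F : Submodule ℂ E), IsOpen O ∧ IsOpenEmbedding ψ ∧ x ∈ Set.range ψ ∧
      (∀ o, ψ o ∈ Z ↔ (o : E) ∈ F) ∧ finrank ℂ F = e ∧ finrank ℂ (E ⧸ F) = c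

/-- One chart suffices: since `Z` is irreducible, its closure is the closure of its part inside the
chart. -/
theorem codim_eq_of_hasLinearChart {X : Type u} [TopologicalSpace X] {Z : Set X}
    (hZ : IsIrreducible Z) {e c : ℕ} {x : X} (hx : x ∈ Z) (h : HasLinearChart Z e c x) :
    codim Z = c := by
  obtain ⟨E, _, _, _, O, ψ, F, hO, hψ, ⟨o, rfl⟩, hF, he, hc⟩ := h
  rw [codim_eq_coheight ⟨closure Z, hZ.closure, isClosed_closure⟩ rfl]
  have hj : IsOpenEmbedding (Subtype.val : O → E) := hO.isOpenEmbedding_subtypeVal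
  let V := (IrreducibleCloseds.orderIsoOfIsOpenEmbedding _ hj).symm
    ⟨affineCell 0 F, o, by simpa using (hF o).1 hx⟩
  have hV : IrreducibleCloseds.map _ hj.continuous V = affineCell 0 F :=
    congrArg Subtype.val ((IrreducibleCloseds.orderIsoOfIsOpenEmbedding _ hj).apply_symm_apply
      ⟨affineCell 0 F, o, by simpa using (hF o).1 hx⟩)
  have hV' : (V : Set O) = ψ ⁻¹' Z := by
    ext o'
    rw [Set.mem_preimage, hF, ← SetLike.mem_coe (p := F), ← coe_affineCell_zero]
    rfl
  have hY : (⟨closure Z, hZ.closure, isClosed_closure⟩ : IrreducibleCloseds X) =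
      IrreducibleCloseds.map ψ hψ.continuous V := by
    ext1
    rw [IrreducibleCloseds.coe_map, ← V.isClosed.closure_eq, hV',
      ← hψ.isOpenMap.preimage_closure_eq_closure_preimage hψ.continuous]
    exact (closure_image_preimage_of_isPreirreducible ψ hψ.isOpenMap (closure Z)
      ⟨o, Set.mem_preimage.2 (subset_closure hx)⟩
      hZ.closure.2 isClosed_closure).symm
  rw [hY, hψ.coheight_map, ← hj.coheight_map, hV, coheight_affineCell, hc]

/-- With a chart at every point, `Z` is covered by open pieces that are open in vector spaces of
dimension `e`; irreducibility is not involved. -/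
theorem dim_eq_of_hasLinearChart {X : Type u} [TopologicalSpace X] {Z : Set X}
    (hZ : Z.Nonempty) {e c : ℕ} (h : ∀ x ∈ Z, HasLinearChart Z e c x) :
    topologicalKrullDim Z = (e : ℕ∞) := by
  have key : ∀ x : Z, ∃ (Y : Type u) (_ : TopologicalSpace Y) (j : Y → Z), IsOpenEmbedding j ∧
      x ∈ Set.range j ∧ topologicalKrullDim Y = (e : ℕ∞) := by
    rintro ⟨x, hx⟩
    obtain ⟨E, _, _, _, O, ψ, F, hO, hψ, ⟨o, rfl⟩, hF, he, hc⟩ := h x hx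
    refine ⟨ψ ⁻¹' Z, inferInstance, Z.restrictPreimage ψ, hψ.restrictPreimage Z, ⟨⟨o, hx⟩, rfl⟩, ?_⟩
    let j : ψ ⁻¹' Z → F := fun y => ⟨y.1.1, (hF _).1 y.2⟩
    have hj : @IsOpenEmbedding (ψ ⁻¹' Z) F _ (zariski F) j := by
      refine isOpenEmbedding_of_linear_comp F.subtype F.injective_subtype j
        (IsEmbedding.subtypeVal.comp IsEmbedding.subtypeVal) hO ?_
      ext f
      refine ⟨?_, fun hf => ?_⟩
      · rintro ⟨y, rfl⟩
        exact y.1.2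
      · exact ⟨⟨⟨f.1, hf⟩, (hF ⟨f.1, hf⟩).2 f.2⟩, rfl⟩
    have : Nonempty (ψ ⁻¹' Z) := ⟨⟨o, hx⟩⟩
    rw [← he]
    exact topologicalKrullDim_isOpenEmbedding_zariski hj
  refine le_antisymm (topologicalKrullDim_le_of_charts fun x => ?_) ?_
  · obtain ⟨Y, i, j, h1, h2, h3⟩ := key x
    exact ⟨Y, i, j, h1, h2, h3.le⟩
  · obtain ⟨x, hx⟩ := hZ
    obtain ⟨Y, i, j, h1, h2, h3⟩ := key ⟨x, hx⟩
    exact h3.symm.le.trans h1.isInducing.topologicalKrullDim_le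

end Charts

end

section

attribute [local instance] zariski

/-! ### Regular functions and regular families of vectors and tensors. -/

section Regular

variable {A : Type*} [AddCommGroup A] [Module ℂ A] (S : Set A)

/-- The algebra of regular functions on a subset of a vector space. -/
def reg : Subalgebra ℂ (S → ℂ) where
  carrier := {f | ∀ x, (subsetStructure S).RegularAt f x}
  mul_mem' {f g} hf hg x := by
    obtain ⟨O, hO, hxO, p, s, h⟩ := hf x
    obtain ⟨O', hO', hxO', p', s', h'⟩ := hg x
    refine ⟨O ∩ O', hO.inter hO', ⟨hxO, hxO'⟩, p * p', s * s', fun y hy => ?_⟩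
    obtain ⟨h1, h2⟩ := h y hy.1
    obtain ⟨h3, h4⟩ := h' y hy.2
    exact ⟨mul_ne_zero h1 h3, by simp [h2, h4, div_mul_div_comm]⟩
  add_mem' {f g} hf hg x := by
    obtain ⟨O, hO, hxO, p, s, h⟩ := hf x
    obtain ⟨O', hO', hxO', p', s', h'⟩ := hg x
    refine ⟨O ∩ O', hO.inter hO', ⟨hxO, hxO'⟩, p * s' + s * p', s * s', fun y hy => ?_⟩
    obtain ⟨h1, h2⟩ := h y hy.1
    obtain ⟨h3, h4⟩ := h' y hy.2
    exact ⟨mul_ne_zero h1 h3, by simp [h2, h4, div_add_div _ _ h1 h3]⟩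
  algebraMap_mem' c x := ⟨Set.univ, isOpen_univ, trivial, algebraMap ℂ _ c, 1, by simp⟩

variable {S}

theorem polyFun_mem_reg {p : A → ℂ} (hp : p ∈ polyFun A) : (fun s : S => p s) ∈ reg S :=
  fun _ => ⟨Set.univ, isOpen_univ, trivial, ⟨p, hp⟩, 1, by simp⟩

theorem inv_mem_reg {f : S → ℂ} (hf : f ∈ reg S) (h0 : ∀ x, f x ≠ 0) :
    (fun x => (f x)⁻¹) ∈ reg S := by
  intro x
  obtain ⟨O, hO, hxO, p, s, h⟩ := hf x
  refine ⟨O, hO, hxO, s, p, fun y hy => ?_⟩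
  obtain ⟨h1, h2⟩ := h y hy
  refine ⟨fun h3 => h0 y (by simp [h2, h3]), by simp [h2]⟩

theorem isOpen_ne_reg {f : S → ℂ} (hf : f ∈ reg S) : IsOpen {x | f x ≠ 0} := by
  rw [isOpen_iff_forall_mem_open]
  intro x hx
  obtain ⟨O, hO, hxO, p, s, h⟩ := hf x
  refine ⟨O ∩ Subtype.val ⁻¹' {a | (p : A → ℂ) a ≠ 0}, ?_,
    hO.inter ((isOpen_ne_polyFun p.2).preimage continuous_subtype_val), hxO, ?_⟩
  · rintro y ⟨hyO, hy⟩
    obtain ⟨h1, h2⟩ := h y hyO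
    simpa [h2, h1] using hy
  · obtain ⟨h1, h2⟩ := h x hxO
    rw [Set.mem_ofPred_eq, h2] at hx
    exact fun h3 => hx (by simp [h3])

/-- A map to a vector space is regular if its coordinates are. -/
def IsRegularMap {M : Type*} [AddCommGroup M] [Module ℂ M] (f : S → M) : Prop :=
  ∀ l : Dual ℂ M, (fun s => l (f s)) ∈ reg S

theorem IsRegularMap.polyFun_comp {M : Type*} [AddCommGroup M] [Module ℂ M] {f : S → M}
    (hf : IsRegularMap f) {p : M → ℂ} (hp : p ∈ polyFun M) : (fun s => p (f s)) ∈ reg S := by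
  induction hp using Algebra.adjoin_induction with
  | mem g hg =>
    obtain ⟨l, rfl⟩ := hg
    exact hf l
  | algebraMap c => exact Subalgebra.algebraMap_mem _ c
  | add f g _ _ hf hg => exact Subalgebra.add_mem _ hf hg
  | mul f g _ _ hf hg => exact Subalgebra.mul_mem _ hf hg

theorem IsRegularMap.continuous {M : Type*} [AddCommGroup M] [Module ℂ M] {f : S → M}
    (hf : IsRegularMap f) : Continuous f := by
  refine ⟨fun O hO => ?_⟩
  rw [isOpen_iff_forall_mem_open]
  intro x hx
  obtain ⟨p, hp, hpx, hpO⟩ := exists_polyFun_of_isOpen hO hx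
  exact ⟨_, fun y hy => hpO _ hy, isOpen_ne_reg (hf.polyFun_comp hp), hpx⟩

theorem IsRegularMap.prodMk {M N : Type*} [AddCommGroup M] [Module ℂ M] [AddCommGroup N]
    [Module ℂ N] {f : S → M} {g : S → N} (hf : IsRegularMap f) (hg : IsRegularMap g) :
    IsRegularMap fun s => (f s, g s) := by
  intro l
  have := Subalgebra.add_mem _ (hf (l ∘ₗ LinearMap.inl ℂ M N)) (hg (l ∘ₗ LinearMap.inr ℂ M N))
  convert this using 1
  ext s
  simp [← map_add]

theorem IsRegularMap.pi {ι : Type*} [Finite ι] {M : ι → Type*} [∀ i, AddCommGroup (M i)]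
    [∀ i, Module ℂ (M i)] {f : S → ∀ i, M i} (hf : ∀ i, IsRegularMap fun s => f s i) :
    IsRegularMap f := by
  classical
  have := Fintype.ofFinite ι
  intro l
  have := Subalgebra.sum_mem (reg S) (t := Finset.univ)
    fun i _ => hf i (l ∘ₗ LinearMap.single ℂ M i)
  convert this using 1
  ext s
  simp [← map_sum, Finset.univ_sum_single]

theorem IsRegularMap.codRestrict {M : Type*} [AddCommGroup M] [Module ℂ M] {N : Submodule ℂ M}
    {f : S → N} (hf : IsRegularMap fun s => (f s : M)) : IsRegularMap f := by
  intro l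
  obtain ⟨l', hl'⟩ := l.exists_extend
  have := hf l'
  convert this using 1
  ext s
  rw [← hl']
  rfl

variable (S) in
/-- The maps from `S` to a vector space which are finite sums of regular functions times constant
vectors. -/
def regMap (M : Type*) [AddCommGroup M] [Module ℂ M] : Submodule ℂ (S → M) :=
  Submodule.span ℂ {f | ∃ g ∈ reg S, ∃ m : M, f = fun s => g s • m}

variable {M N : Type*} [AddCommGroup M] [Module ℂ M] [AddCommGroup N] [Module ℂ N]

theorem smul_const_mem_regMap {g : S → ℂ} (hg : g ∈ reg S) (m : M) :
    (fun s => g s • m) ∈ regMap S M :=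
  Submodule.subset_span ⟨g, hg, m, rfl⟩

theorem const_mem_regMap (m : M) : (fun _ => m) ∈ regMap S M := by
  simpa using smul_const_mem_regMap (S := S) (Subalgebra.one_mem _) m

/-- Elements of `regMap` are finite combinations of constant vectors, so a varying family of linear
maps `T s` only has to be tested on constants. This works in the infinite-dimensional symmetric
algebra too. -/
theorem regMap_induction {K : Submodule ℂ (S → N)} (T : S → M →ₗ[ℂ] N)
    (h : ∀ g ∈ reg S, ∀ m, (fun s => g s • T s m) ∈ K) {f : S → M} (hf : f ∈ regMap S M) :
    (fun s => T s (f s)) ∈ K := by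
  have : regMap S M ≤ K.comap (LinearMap.pi fun s => T s ∘ₗ LinearMap.proj s) := by
    refine Submodule.span_le.2 ?_
    rintro _ ⟨g, hg, m, rfl⟩
    simpa [LinearMap.pi] using h g hg m
  exact this hf

theorem linear_comp_mem_regMap (T : M →ₗ[ℂ] N) {f : S → M} (hf : f ∈ regMap S M) :
    (fun s => T (f s)) ∈ regMap S N :=
  regMap_induction (fun _ => T) (fun _ hg m => smul_const_mem_regMap hg (T m)) hf

theorem functional_mem_reg (l : Dual ℂ M) {f : S → M} (hf : f ∈ regMap S M) :
    (fun s => l (f s)) ∈ reg S :=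
  regMap_induction (K := (reg S).toSubmodule) (fun _ => l)
    (fun _ hg m => Subalgebra.mul_mem _ hg (Subalgebra.algebraMap_mem _ (l m))) hf

theorem isRegularMap_of_mem_regMap {f : S → M} (hf : f ∈ regMap S M) : IsRegularMap f :=
  fun l => functional_mem_reg l hf

theorem smul_mem_regMap {g : S → ℂ} (hg : g ∈ reg S) {f : S → M} (hf : f ∈ regMap S M) :
    (fun s => g s • f s) ∈ regMap S M := by
  refine regMap_induction (fun s => g s • LinearMap.id) (fun g' hg' m => ?_) hf
  simpa [smul_smul] using smul_const_mem_regMap (Subalgebra.mul_mem _ hg' hg) m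

theorem mul_mem_regMap {R : Type*} [CommRing R] [Algebra ℂ R] {f g : S → R}
    (hf : f ∈ regMap S R) (hg : g ∈ regMap S R) : (fun s => f s * g s) ∈ regMap S R := by
  refine regMap_induction (fun s => LinearMap.mulRight ℂ (g s)) (fun f' hf' m => ?_) hf
  exact smul_mem_regMap hf' (linear_comp_mem_regMap (LinearMap.mulLeft ℂ m) hg)

theorem linear_mem_regMap [FiniteDimensional ℂ A] (T : A →ₗ[ℂ] M) :
    (fun s : S => T s) ∈ regMap S M := by
  have : (fun s : S => T s) =
      ∑ i, fun s : S => (finBasis ℂ A).coord i s • T (finBasis ℂ A i) := by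
    ext s
    conv_lhs => rw [← (finBasis ℂ A).sum_repr (s : A), map_sum]
    simp
  rw [this]
  exact Submodule.sum_mem _ fun i _ =>
    smul_const_mem_regMap (polyFun_mem_reg (linear_mem_polyFun _)) _

/-- For a fixed tensor the substitution is a polynomial in the images of generators; linearity then
handles a varying tensor. -/
theorem aeval_mem_regMap {W R : Type*} [AddCommGroup W] [Module ℂ W] [CommRing R] [Algebra ℂ R]
    {F : S → W →ₗ[ℂ] R} (hF : ∀ w, (fun s => F s w) ∈ regMap S R)
    {q : S → SymmetricAlgebra ℂ W} (hq : q ∈ regMap S (SymmetricAlgebra ℂ W)) :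
    (fun s => SymmetricAlgebra.lift (F s) (q s)) ∈ regMap S R := by
  have key : ∀ p : SymmetricAlgebra ℂ W,
      (fun s => SymmetricAlgebra.lift (F s) p) ∈ regMap S R := by
    intro p
    induction p using SymmetricAlgebra.induction with
    | algebraMap c => simpa using const_mem_regMap (S := S) (algebraMap ℂ R c)
    | ι w => simpa using hF w
    | mul p q hp hq => simpa only [map_mul] using mul_mem_regMap hp hq
    | add p q hp hq => simpa only [map_add] using! Submodule.add_mem _ hp hq
  exact regMap_induction (fun s => (SymmetricAlgebra.lift (F s)).toLinearMap)
    (fun g hg m => smul_mem_regMap hg (key m)) hq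

theorem det_mem_subalgebra {X : Type*} (R : Subalgebra ℂ (X → ℂ)) {ι : Type*} [Fintype ι]
    [DecidableEq ι] {P : X → Matrix ι ι ℂ} (hP : ∀ i j, (fun s => P s i j) ∈ R) :
    (fun s => (P s).det) ∈ R := by
  simp only [Matrix.det_apply]
  have : (fun s => ∑ σ : Equiv.Perm ι, Equiv.Perm.sign σ • ∏ i, P s (σ i) i) =
      ∑ σ : Equiv.Perm ι, (Equiv.Perm.sign σ : ℤ) • ∏ i, fun s => P s (σ i) i := by
    ext s
    simp [Units.smul_def]
  rw [this]
  exact Subalgebra.sum_mem _ fun σ _ => Subalgebra.zsmul_mem _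
    (Subalgebra.prod_mem _ fun i _ => hP _ _) _

theorem inv_matrix_mem_reg {ι : Type*} [Fintype ι] [DecidableEq ι] {P : S → Matrix ι ι ℂ}
    (hP : ∀ i j, (fun s => P s i j) ∈ reg S) (h0 : ∀ s, (P s).det ≠ 0) (i j : ι) :
    (fun s => (P s)⁻¹ i j) ∈ reg S := by
  simp only [Matrix.inv_def, Matrix.smul_apply, Ring.inverse_eq_inv', Matrix.adjugate_apply,
    smul_eq_mul]
  refine Subalgebra.mul_mem _ (inv_mem_reg (det_mem_subalgebra _ hP) h0) (det_mem_subalgebra _ fun i' j' => ?_)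
  by_cases h : i' = j
  · subst h
    simp only [Matrix.updateRow_self]
    exact Subalgebra.algebraMap_mem (reg S) (Pi.single (M := fun _ => ℂ) i 1 j')
  · simpa [h] using hP i' j'

theorem mul_matrix_mem_reg {ι κ τ : Type*} [Fintype κ] {P : S → Matrix ι κ ℂ}
    {Q : S → Matrix κ τ ℂ} (hP : ∀ i j, (fun s => P s i j) ∈ reg S)
    (hQ : ∀ i j, (fun s => Q s i j) ∈ reg S) (i : ι) (j : τ) :
    (fun s => (P s * Q s) i j) ∈ reg S := by
  have : (fun s => (P s * Q s) i j) = ∑ l, (fun s => P s i l) * fun s => Q s l j := by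
    ext s
    simp [Matrix.mul_apply]
  rw [this]
  exact Subalgebra.sum_mem _ fun l _ => Subalgebra.mul_mem _ (hP _ _) (hQ _ _)

/-- A left inverse `π` of the combination map at `x` turns the family into a square matrix, equal to
the identity at `x`; where its determinant is nonzero the vectors stay independent. -/
theorem isOpen_linearIndependent {n : Type*} [Finite n] {f : S → n → M}
    (hf : ∀ i, IsRegularMap fun s => f s i) : IsOpen {s | LinearIndependent ℂ (f s)} := by
  classical
  have := Fintype.ofFinite n
  rw [isOpen_iff_forall_mem_open]
  intro x hx
  obtain ⟨π, hπ⟩ := (Fintype.linearCombination ℂ (f x)).exists_leftInverse_of_injective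
    ((LinearMap.ker_eq_bot.2
      (linearIndependent_iff_injective_fintypeLinearCombination.1 hx)))
  let P : S → Matrix n n ℂ := fun s => Matrix.of fun i j => π (f s i) j
  refine ⟨{s | (P s).det ≠ 0}, fun s hs => ?_,
    isOpen_ne_reg (det_mem_subalgebra _ fun i j => hf i (LinearMap.proj j ∘ₗ π)), ?_⟩
  · refine LinearIndependent.of_comp π ?_
    exact Matrix.linearIndependent_rows_iff_isUnit.2
      ((Matrix.isUnit_iff_isUnit_det _).2 (isUnit_iff_ne_zero.2 hs))
  · have : P x = 1 := by
      ext i j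
      have h := congrFun (LinearMap.congr_fun hπ (Pi.single i 1)) j
      simpa [P, Fintype.linearCombination_apply_single, Pi.single_apply, Matrix.one_apply, eq_comm]
        using h
    simp [this]

end Regular

end

/-! ### Functoriality and contractions of the symmetric algebra. -/

section SymmetricAlgebra

open SymmetricAlgebra

variable {W W' W'' : Type*} [AddCommGroup W] [Module ℂ W] [AddCommGroup W'] [Module ℂ W']
  [AddCommGroup W''] [Module ℂ W'']

/-- The homomorphism of symmetric algebras induced by a linear map. -/
def symMap (g : W →ₗ[ℂ] W') : SymmetricAlgebra ℂ W →ₐ[ℂ] SymmetricAlgebra ℂ W' :=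
  lift (ι ℂ W' ∘ₗ g)

@[simp] theorem symMap_ι (g : W →ₗ[ℂ] W') (w : W) : symMap g (ι ℂ W w) = ι ℂ W' (g w) := by
  simp [symMap]

theorem symMap_symMap (h : W' →ₗ[ℂ] W'') (g : W →ₗ[ℂ] W') (q : SymmetricAlgebra ℂ W) :
    symMap h (symMap g q) = symMap (h ∘ₗ g) q := by
  have : (symMap h).comp (symMap g) = symMap (h ∘ₗ g) := by
    ext
    simp
  exact DFunLike.congr_fun this q

@[simp] theorem symMap_id (q : SymmetricAlgebra ℂ W) : symMap LinearMap.id q = q := by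
  have : symMap (LinearMap.id : W →ₗ[ℂ] W) = AlgHom.id ℂ _ := by
    ext
    simp
  exact DFunLike.congr_fun this q

theorem map_symMap_pow (g : W →ₗ[ℂ] W') (L : Submodule ℂ W) (d : ℕ) :
    (L.map (ι ℂ W) ^ d).map (symMap g).toLinearMap = (L.map g).map (ι ℂ W') ^ d := by
  rw [Submodule.map_pow, ← Submodule.map_comp, ← Submodule.map_comp]
  congr 2
  ext
  simp

/-- The derivation of the symmetric algebra which contracts with a linear form. -/
def symDeriv (v : Dual ℂ W) : SymmetricAlgebra ℂ W →ₗ[ℂ] SymmetricAlgebra ℂ W :=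
  let e := equivMvPolynomial (Free.chooseBasis ℂ W)
  e.symm.toLinearMap ∘ₗ (MvPolynomial.mkDerivation ℂ
    fun i => MvPolynomial.C (v (Free.chooseBasis ℂ W i))).toLinearMap ∘ₗ e.toLinearMap

@[simp] theorem symDeriv_mul (v : Dual ℂ W) (p q : SymmetricAlgebra ℂ W) :
    symDeriv v (p * q) = p * symDeriv v q + q * symDeriv v p := by
  simp [symDeriv]

@[simp] theorem symDeriv_algebraMap (v : Dual ℂ W) (c : ℂ) :
    symDeriv v (algebraMap ℂ _ c) = 0 := by
  simp [symDeriv]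

@[simp] theorem symDeriv_ι (v : Dual ℂ W) (w : W) :
    symDeriv v (ι ℂ W w) = algebraMap ℂ _ (v w) := by
  have : symDeriv v ∘ₗ ι ℂ W = Algebra.linearMap ℂ _ ∘ₗ v := by
    refine (Free.chooseBasis ℂ W).ext fun i => ?_
    simpa [symDeriv] using (equivMvPolynomial (Free.chooseBasis ℂ W)).symm.commutes _
  exact LinearMap.congr_fun this w

/-- The Leibniz rule along `φ` propagates agreement from generators to products. Bare functions are
allowed so that composites of contractions and homomorphisms fit directly. -/
theorem symDeriv_ext {R : Type*} [CommRing R] {δ δ' : SymmetricAlgebra ℂ W → R}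
    (φ : SymmetricAlgebra ℂ W → R)
    (hadd : ∀ p q, δ (p + q) = δ p + δ q) (hadd' : ∀ p q, δ' (p + q) = δ' p + δ' q)
    (hmul : ∀ p q, δ (p * q) = φ p * δ q + φ q * δ p)
    (hmul' : ∀ p q, δ' (p * q) = φ p * δ' q + φ q * δ' p)
    (hc : ∀ c, δ (algebraMap ℂ _ c) = 0) (hc' : ∀ c, δ' (algebraMap ℂ _ c) = 0)
    (hι : ∀ w, δ (ι ℂ W w) = δ' (ι ℂ W w)) (q : SymmetricAlgebra ℂ W) : δ q = δ' q := by
  induction q using SymmetricAlgebra.induction with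
  | algebraMap c => rw [hc, hc']
  | ι w => exact hι w
  | mul p q hp hq => rw [hmul, hmul', hp, hq]
  | add p q hp hq => rw [hadd, hadd', hp, hq]

theorem symDeriv_symMap (g : W →ₗ[ℂ] W') (v : Dual ℂ W') (q : SymmetricAlgebra ℂ W) :
    symDeriv v (symMap g q) = symMap g (symDeriv (v ∘ₗ g) q) := by
  refine symDeriv_ext (δ := fun q => symDeriv v (symMap g q))
    (δ' := fun q => symMap g (symDeriv (v ∘ₗ g) q)) (symMap g) ?_ ?_ ?_ ?_ ?_ ?_ ?_ q <;> simp

/-- The map `v ↦ ∂_v q` which contracts linear forms with `q`. -/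
def contract (q : SymmetricAlgebra ℂ W) : Dual ℂ W →ₗ[ℂ] SymmetricAlgebra ℂ W where
  toFun v := symDeriv v q
  map_add' v w := by
    refine symDeriv_ext (δ := symDeriv (v + w)) (δ' := fun q => symDeriv v q + symDeriv w q)
      id ?_ ?_ ?_ ?_ ?_ ?_ ?_ q <;> intros <;> simp <;> ring
  map_smul' c v := by
    refine symDeriv_ext (δ := symDeriv (c • v)) (δ' := fun q => c • symDeriv v q)
      id ?_ ?_ ?_ ?_ ?_ ?_ ?_ q <;> intros <;> simp [Algebra.smul_def] <;> ring

@[simp] theorem contract_apply (q : SymmetricAlgebra ℂ W) (v : Dual ℂ W) :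
    contract q v = symDeriv v q := rfl

theorem equivMvPolynomial_symDeriv {κ : Type*} (b : Basis κ ℂ W) (i : κ)
    (q : SymmetricAlgebra ℂ W) :
    equivMvPolynomial b (symDeriv (b.coord i) q) =
      MvPolynomial.pderiv i (equivMvPolynomial b q) := by
  classical
  refine symDeriv_ext (δ := fun q => equivMvPolynomial b (symDeriv (b.coord i) q))
    (δ' := fun q => MvPolynomial.pderiv i (equivMvPolynomial b q)) (equivMvPolynomial b)
    ?_ ?_ ?_ ?_ ?_ ?_ (fun w => ?_) q
  any_goals simp
  have : (Algebra.linearMap ℂ _) ∘ₗ b.coord i =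
      (MvPolynomial.pderiv i).toLinearMap ∘ₗ (equivMvPolynomial b).toLinearMap ∘ₗ ι ℂ W := by
    refine b.ext fun j => ?_
    simp [MvPolynomial.pderiv_X, Finsupp.single_apply, Pi.single_apply]
  simpa using LinearMap.congr_fun this w

theorem symDeriv_eq_zero_of_mem_adjoin {L : Submodule ℂ W} {v : Dual ℂ W}
    (hv : v ∈ L.dualAnnihilator) {q : SymmetricAlgebra ℂ W}
    (hq : q ∈ Algebra.adjoin ℂ (L.map (ι ℂ W) : Set (SymmetricAlgebra ℂ W))) :
    symDeriv v q = 0 := by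
  induction hq using Algebra.adjoin_induction with
  | mem x hx =>
    obtain ⟨l, hl, rfl⟩ := hx
    simp [(Submodule.mem_dualAnnihilator v).1 hv l hl]
  | algebraMap c => simp
  | add p q _ _ hp hq => simp [hp, hq]
  | mul p q _ _ hp hq => simp [hp, hq]

/-- In characteristic zero a polynomial with vanishing partial derivative does not involve that
variable. -/
theorem mem_adjoin_of_symDeriv_eq_zero {κ : Type*} (b : Basis κ ℂ W) (s : Set κ)
    {q : SymmetricAlgebra ℂ W} (hq : ∀ i ∉ s, symDeriv (b.coord i) q = 0) :
    q ∈ Algebra.adjoin ℂ ((fun i => ι ℂ W (b i)) '' s) := by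
  have hf : equivMvPolynomial b q ∈ MvPolynomial.supported ℂ s := by
    rw [MvPolynomial.mem_supported]
    intro i hi
    by_contra his
    obtain ⟨m, hm, him⟩ := (MvPolynomial.mem_vars_iff_mem_support i).1 hi
    have h0 : MvPolynomial.pderiv i (equivMvPolynomial b q) = 0 := by
      rw [← equivMvPolynomial_symDeriv, hq i his, map_zero]
    -- Lowering the exponent of `i` in `m` by one gives a monomial whose coefficient in the
    -- derivative is the coefficient of `m` times the positive integer `m i`.
    have h1 := congrArg (MvPolynomial.coeff (m - Finsupp.single i 1)) h0
    have hle : Finsupp.single i 1 ≤ m := by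
      rw [Finsupp.single_le_iff]
      exact Nat.one_le_iff_ne_zero.2 (Finsupp.mem_support_iff.1 him)
    rw [MvPolynomial.coeff_pderiv, tsub_add_cancel_of_le hle, MvPolynomial.coeff_zero,
      mul_eq_zero] at h1
    rcases h1 with h1 | h1
    · exact MvPolynomial.mem_support_iff.1 hm h1
    · exact Nat.cast_add_one_ne_zero _ h1
  rw [MvPolynomial.supported_eq_adjoin_X] at hf
  have h2 : (equivMvPolynomial b).symm.toAlgHom (equivMvPolynomial b q) ∈
      (Algebra.adjoin ℂ (MvPolynomial.X '' s)).map (equivMvPolynomial b).symm.toAlgHom :=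
    ⟨_, hf, rfl⟩
  rw [AlgHom.map_adjoin, ← Set.image_comp] at h2
  simpa [Function.comp_def] using h2

theorem mem_symPowOf {d : ℕ} {L : Submodule ℂ W} {q : symPow W d} :
    q ∈ symPowOf d L ↔ (q : SymmetricAlgebra ℂ W) ∈ L.map (ι ℂ W) ^ d := Iff.rfl

theorem pow_le_adjoin {R : Type*} [CommRing R] [Algebra ℂ R] (P : Submodule ℂ R) (d : ℕ) :
    P ^ d ≤ (Algebra.adjoin ℂ (P : Set R)).toSubmodule := by
  have h : P ≤ (Algebra.adjoin ℂ (P : Set R)).toSubmodule := Algebra.subset_adjoin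
  induction d with
  | zero => simp
  | succ d ih =>
    rw [pow_succ, Submodule.mul_le]
    exact fun p hp q hq => Subalgebra.mul_mem _ (ih hp) (h hq)

/-- For the converse, in a basis adapted to `L` and a complement, `q` involves only variables from
`L`. Hence the projection to `L` fixes `q`, and this projection carries `S^d W` into `S^d L`. -/
theorem mem_symPowOf_iff_symDeriv {d : ℕ} {L : Submodule ℂ W} {q : symPow W d} :
    q ∈ symPowOf d L ↔ L.dualAnnihilator ≤ LinearMap.ker (contract (q : SymmetricAlgebra ℂ W)) := by
  constructor
  · intro hq v hv
    exact symDeriv_eq_zero_of_mem_adjoin hv (pow_le_adjoin _ _ (mem_symPowOf.1 hq))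
  · intro h
    obtain ⟨L', hL'⟩ := L.exists_isCompl
    let b := ((Free.chooseBasis ℂ L).prod (Free.chooseBasis ℂ L')).map
      (Submodule.prodEquivOfIsCompl L L' hL')
    have hb : ∀ i, b (Sum.inl i) = Free.chooseBasis ℂ L i := by simp [b]
    have hq := mem_adjoin_of_symDeriv_eq_zero b (Set.range Sum.inl)
      (q := (q : SymmetricAlgebra ℂ W)) (by
        rintro (i | j) hi
        · exact absurd ⟨i, rfl⟩ hi
        · refine h ((Submodule.mem_dualAnnihilator _).2 fun l hl => ?_)
          have := Submodule.prodEquivOfIsCompl_symm_apply_left L L' hL' ⟨l, hl⟩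
          simp only at this
          simp [b, this])
    obtain ⟨π, hπ⟩ := L.subtype.exists_leftInverse_of_injective L.ker_subtype
    have hfix : symMap (L.subtype ∘ₗ π) (q : SymmetricAlgebra ℂ W) = q := by
      have : Set.EqOn (symMap (L.subtype ∘ₗ π)) (AlgHom.id ℂ _)
          ((fun i => ι ℂ W (b i)) '' Set.range Sum.inl) := by
        rintro _ ⟨_, ⟨i, rfl⟩, rfl⟩
        have := LinearMap.congr_fun hπ (Free.chooseBasis ℂ L i)
        simp only [LinearMap.comp_apply, Submodule.subtype_apply, LinearMap.id_apply] at this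
        simp [hb, this]
      exact AlgHom.eqOn_adjoin_iff.2 this hq
    rw [mem_symPowOf, ← hfix]
    have h1 : symMap (L.subtype ∘ₗ π) (q : SymmetricAlgebra ℂ W) ∈
        (((⊤ : Submodule ℂ W).map (ι ℂ W)) ^ d).map (symMap (L.subtype ∘ₗ π)).toLinearMap := by
      refine ⟨q, ?_, rfl⟩
      rw [Submodule.map_top]
      exact q.2
    rw [map_symMap_pow] at h1
    refine pow_le_pow_left' (Submodule.map_mono ?_) d h1
    rintro _ ⟨w, -, rfl⟩
    simp

end SymmetricAlgebra

/-! ### Symmetric powers, their dimension, and the rank of a tensor. -/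

section SymmetricPower

open SymmetricAlgebra

variable {W W' W'' : Type*} [AddCommGroup W] [Module ℂ W] [AddCommGroup W'] [Module ℂ W']
  [AddCommGroup W''] [Module ℂ W''] {d : ℕ}

instance [FiniteDimensional ℂ W] : FiniteDimensional ℂ (symPow W d) :=
  Module.Finite.iff_fg.2 (Submodule.FG.pow (Module.Finite.iff_fg.1 inferInstance) d)

theorem symPowOf_mono {L L' : Submodule ℂ W} (h : L ≤ L') : symPowOf d L ≤ symPowOf d L' :=
  fun _ hq => pow_le_pow_left' (Submodule.map_mono h) d hq

/-- The linear map of symmetric powers induced by a linear map. -/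
def symPowMap (d : ℕ) (g : W →ₗ[ℂ] W') : symPow W d →ₗ[ℂ] symPow W' d :=
  (symMap g).toLinearMap.restrict fun q hq => by
    have : (symMap g).toLinearMap q ∈ _ := Submodule.mem_map_of_mem (f := (symMap g).toLinearMap) hq
    rw [symPow, ← Submodule.map_top, map_symMap_pow, ← Submodule.map_comp] at this
    exact pow_le_pow_left' ((LinearMap.map_le_range).trans (LinearMap.range_comp_le_range _ _)) d this

@[simp] theorem coe_symPowMap (g : W →ₗ[ℂ] W') (q : symPow W d) :
    (symPowMap d g q : SymmetricAlgebra ℂ W') = symMap g q := rfl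

theorem symPowMap_symPowMap (h : W' →ₗ[ℂ] W'') (g : W →ₗ[ℂ] W') (q : symPow W d) :
    symPowMap d h (symPowMap d g q) = symPowMap d (h ∘ₗ g) q :=
  Subtype.ext (symMap_symMap _ _ _)

@[simp] theorem symPowMap_id (q : symPow W d) : symPowMap d LinearMap.id q = q :=
  Subtype.ext (symMap_id _)

theorem map_symPowMap (g : W →ₗ[ℂ] W') (L : Submodule ℂ W) :
    (symPowOf d L).map (symPowMap d g) = symPowOf d (L.map g) := by
  ext q
  rw [mem_symPowOf, ← map_symMap_pow]
  constructor
  · rintro ⟨p, hp, rfl⟩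
    exact ⟨p, hp, rfl⟩
  · rintro ⟨p, hp, hpq⟩
    have hp' : p ∈ symPow W d := pow_le_pow_left' LinearMap.map_le_range d hp
    exact ⟨⟨p, hp'⟩, hp, Subtype.ext hpq⟩

theorem symPowMap_mem {g : W →ₗ[ℂ] W'} {L : Submodule ℂ W} {q : symPow W d}
    (hq : q ∈ symPowOf d L) : symPowMap d g q ∈ symPowOf d (L.map g) := by
  rw [← map_symPowMap]
  exact ⟨q, hq, rfl⟩

theorem symPowOf_top : symPowOf d (⊤ : Submodule ℂ W) = ⊤ := by
  rw [eq_top_iff]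
  intro q _
  rw [mem_symPowOf, Submodule.map_top]
  exact q.2

theorem symPowOf_range_subtype (L : Submodule ℂ W) :
    LinearMap.range (symPowMap d L.subtype) = symPowOf d L := by
  rw [← Submodule.map_top, ← symPowOf_top, map_symPowMap, Submodule.map_top, Submodule.range_subtype]

theorem symMap_eq_self {g : W →ₗ[ℂ] W} {L : Submodule ℂ W} (hg : ∀ w ∈ L, g w = w)
    {q : symPow W d} (hq : q ∈ symPowOf d L) : symPowMap d g q = q := by
  rw [← symPowOf_range_subtype] at hq
  obtain ⟨p, rfl⟩ := hq
  rw [symPowMap_symPowMap]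
  congr 2
  ext w
  exact hg w w.2

theorem finrank_homogeneousSubmodule (n d : ℕ) :
    finrank ℂ (MvPolynomial.homogeneousSubmodule (Fin n) ℂ d) = (n + d - 1).choose d := by
  have h : MvPolynomial.homogeneousSubmodule (Fin n) ℂ d =
      Submodule.span ℂ (Set.range fun m : (Finset.univ : Finset (Fin n)).finsuppAntidiag d =>
        MvPolynomial.basisMonomials (Fin n) ℂ m) := by
    rw [MvPolynomial.homogeneousSubmodule_eq_finsupp_supported,
      AddMonoidAlgebra.supported_eq_span_single]
    congr 1
    ext p
    simp [Finsupp.degree_eq_sum, MvPolynomial.single_eq_monomial]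
  rw [h, finrank_span_eq_card, Fintype.card_coe, Finset.card_finsuppAntidiag_nat_eq_choose]
  · simp
  · exact (MvPolynomial.basisMonomials (Fin n) ℂ).linearIndependent.comp _ Subtype.val_injective

theorem finrank_symPow [FiniteDimensional ℂ W] :
    finrank ℂ (symPow W d) = (finrank ℂ W + d - 1).choose d := by
  rw [← finrank_homogeneousSubmodule]
  let b := finBasis ℂ W
  have h : (symPow W d).map (equivMvPolynomial b).toLinearMap =
      MvPolynomial.homogeneousSubmodule _ ℂ d := by
    rw [symPow, ← MvPolynomial.homogeneousSubmodule_one_pow,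
      MvPolynomial.homogeneousSubmodule_one_eq_span_X]
    have := Submodule.map_pow (LinearMap.range (ι ℂ W)) (equivMvPolynomial b).toAlgHom d
    refine this.trans ?_
    congr 1
    rw [← Submodule.map_top, ← b.span_eq, ← Submodule.map_comp, Submodule.map_span, ← Set.range_comp]
    congr 2
    ext i
    simp [b]
  rw [← h]
  exact (LinearEquiv.finrank_map_eq (equivMvPolynomial b).toLinearEquiv _).symm

theorem symPowMap_injective {g : W →ₗ[ℂ] W'} (hg : Function.Injective g) :
    Function.Injective (symPowMap d g) := by
  obtain ⟨π, hπ⟩ := g.exists_leftInverse_of_injective (LinearMap.ker_eq_bot.2 hg)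
  refine Function.LeftInverse.injective (g := symPowMap d π) fun q => ?_
  rw [symPowMap_symPowMap, hπ, symPowMap_id]

theorem finrank_symPowOf [FiniteDimensional ℂ W] (L : Submodule ℂ W) :
    finrank ℂ (symPowOf d L) = (finrank ℂ L + d - 1).choose d := by
  rw [← symPowOf_range_subtype,
    LinearMap.finrank_range_of_inj (symPowMap_injective L.injective_subtype), finrank_symPow]

variable [FiniteDimensional ℂ W]

theorem mem_symPowOf_iff_dualCoannihilator_le {L : Submodule ℂ W} {q : symPow W d} :
    q ∈ symPowOf d L ↔
      (LinearMap.ker (contract (q : SymmetricAlgebra ℂ W))).dualCoannihilator ≤ L := by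
  rw [mem_symPowOf_iff_symDeriv]
  constructor
  · intro h
    simpa using Submodule.dualCoannihilator_anti h
  · intro h
    have := Submodule.dualAnnihilator_anti h
    rwa [Subspace.dualCoannihilator_dualAnnihilator_eq] at this

/-- The subspaces `L` with `q ∈ S^d L` are all those above one fixed subspace, so the infimum is
attained. -/
theorem minSubspace_eq (q : symPow W d) : minSubspace q =
    (LinearMap.ker (contract (q : SymmetricAlgebra ℂ W))).dualCoannihilator :=
  le_antisymm (sInf_le (mem_symPowOf_iff_dualCoannihilator_le.2 le_rfl))
    (le_sInf fun _ hL => mem_symPowOf_iff_dualCoannihilator_le.1 hL)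

theorem mem_symPowOf_iff {L : Submodule ℂ W} {q : symPow W d} :
    q ∈ symPowOf d L ↔ minSubspace q ≤ L := by
  rw [minSubspace_eq, mem_symPowOf_iff_dualCoannihilator_le]

theorem mem_symPowOf_minSubspace (q : symPow W d) : q ∈ symPowOf d (minSubspace q) :=
  mem_symPowOf_iff.2 le_rfl

theorem rk_eq (q : symPow W d) :
    rk q = finrank ℂ (LinearMap.range (contract (q : SymmetricAlgebra ℂ W))) := by
  have h1 := Subspace.finrank_add_finrank_dualCoannihilator_eq
    (LinearMap.ker (contract (q : SymmetricAlgebra ℂ W)))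
  have h2 := (contract (q : SymmetricAlgebra ℂ W)).finrank_range_add_finrank_ker
  rw [Subspace.dual_finrank_eq] at h2
  rw [rk, minSubspace_eq]
  omega

/-- One inclusion is functoriality; the other is the same inclusion for a left inverse of `g`. -/
theorem minSubspace_symPowMap [FiniteDimensional ℂ W'] {g : W →ₗ[ℂ] W'}
    (hg : Function.Injective g) (q : symPow W d) :
    minSubspace (symPowMap d g q) = (minSubspace q).map g := by
  have hle : minSubspace (symPowMap d g q) ≤ (minSubspace q).map g :=
    mem_symPowOf_iff.1 (symPowMap_mem (mem_symPowOf_minSubspace q))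
  refine le_antisymm hle ?_
  obtain ⟨π, hπ⟩ := g.exists_leftInverse_of_injective (LinearMap.ker_eq_bot.2 hg)
  have h := symPowMap_mem (g := π) (mem_symPowOf_minSubspace (symPowMap d g q))
  rw [symPowMap_symPowMap, hπ, symPowMap_id, mem_symPowOf_iff] at h
  rw [Submodule.map_le_iff_le_comap]
  intro w hw
  obtain ⟨w', hw', rfl⟩ := h hw
  obtain ⟨w, -, rfl⟩ := hle hw'
  rwa [Submodule.mem_comap, ← LinearMap.comp_apply π g, hπ]

theorem rk_symPowMap [FiniteDimensional ℂ W'] {g : W →ₗ[ℂ] W'} (hg : Function.Injective g)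
    (q : symPow W d) : rk (symPowMap d g q) = rk q := by
  rw [rk, minSubspace_symPowMap hg]
  exact (Submodule.equivMapOfInjective g hg _).finrank_eq.symm

theorem exists_finrank_eq_of_le {L : Submodule ℂ W} {k : ℕ} (hL : finrank ℂ L ≤ k)
    (hk : k ≤ finrank ℂ W) : ∃ U, L ≤ U ∧ finrank ℂ U = k := by
  induction k, hL using Nat.le_induction with
  | base => exact ⟨L, le_rfl, rfl⟩
  | succ k hLk ih =>
    obtain ⟨U, hLU, hU⟩ := ih (by omega)
    have hne : U ≠ ⊤ := by
      rintro rfl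
      rw [finrank_top] at hU
      omega
    obtain ⟨w, -, hw⟩ := SetLike.exists_of_lt hne.lt_top
    exact ⟨U ⊔ ℂ ∙ w, hLU.trans le_sup_left, by rw [Submodule.finrank_sup_span_singleton hw, hU]⟩

theorem cone_eq {k : ℕ} (hk : k ≤ finrank ℂ W) : cone W d k = {q | rk q ≤ k} := by
  ext q
  constructor
  · rintro ⟨x, rfl⟩
    exact (Submodule.finrank_mono (mem_symPowOf_iff.1 x.tensor_mem)).trans x.finrank_space.le
  · intro hq
    obtain ⟨U, hLU, hU⟩ := exists_finrank_eq_of_le (L := minSubspace q) hq hk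
    exact ⟨⟨U, hU, q, mem_symPowOf_iff.2 hLU⟩, rfl⟩

end SymmetricPower

/-! ### The isomorphism locus of the collapsing. -/

section Collapsing

open SymmetricAlgebra

variable {W : Type*} [AddCommGroup W] [Module ℂ W] {d k : ℕ}

local instance : TopologicalSpace (symPow W d) := zariski _

local instance : TopologicalSpace ((Fin k → W) × symPow W d) := zariski _

theorem continuous_forgetFrame : Continuous (forgetFrame (W := W) (d := d) (k := k)) :=
  continuous_coinduced_rng

theorem isOpen_symTaut_iff {V : Set (SymTaut W d k)} :
    IsOpen V ↔ IsOpen (forgetFrame (W := W) (d := d) (k := k) ⁻¹' V) :=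
  isOpen_coinduced

theorem continuous_collapsing : Continuous (collapsing W d k) := by
  refine continuous_coinduced_dom.2 ?_
  refine Continuous.subtype_mk (f := fun p : framed W d k => p.1.2) ?_ _
  exact (continuous_zariski_of_linear (LinearMap.snd ℂ (Fin k → W) (symPow W d))).comp
    continuous_subtype_val

variable [FiniteDimensional ℂ W]

theorem forgetFrame_surjective : Function.Surjective (forgetFrame (W := W) (d := d) (k := k)) := by
  rintro ⟨U, rfl, q, hq⟩
  have hspan : Submodule.span ℂ (Set.range fun i => (finBasis ℂ U i : W)) = U := by
    have := congrArg (Submodule.map U.subtype) (finBasis ℂ U).span_eq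
    rw [Submodule.map_span, ← Set.range_comp, Submodule.map_top, Submodule.range_subtype] at this
    exact this
  refine ⟨⟨(fun i => finBasis ℂ U i, q),
    (finBasis ℂ U).linearIndependent.map' U.subtype U.ker_subtype, ?_⟩, SymTaut.ext hspan rfl⟩
  rwa [hspan]

/-- Contraction of a symmetric tensor with a linear form on the symmetric algebra, leaving a
vector. -/
def contractBy (d : ℕ) (θ : Dual ℂ (SymmetricAlgebra ℂ W)) : symPow W d →ₗ[ℂ] W :=
  (evalEquiv ℂ W).symm.toLinearMap ∘ₗ
    { toFun q := θ ∘ₗ contract (q : SymmetricAlgebra ℂ W)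
      map_add' p q := by ext; simp
      map_smul' c q := by ext; simp }

@[simp] theorem apply_contractBy (θ : Dual ℂ (SymmetricAlgebra ℂ W)) (q : symPow W d)
    (v : Dual ℂ W) : v (contractBy d θ q) = θ (symDeriv v q) := by
  simp [contractBy]

/-- A linear form kills every `contractBy d θ q` exactly when it contracts `q` to zero, so these
vectors fill `L_q`. Thus vectors of `L_q` extend to linear functions of the tensor. -/
theorem exists_contractBy_iff {q : symPow W d} {w : W} :
    (∃ θ, contractBy d θ q = w) ↔ w ∈ minSubspace q := by
  let T : Dual ℂ (SymmetricAlgebra ℂ W) →ₗ[ℂ] W :=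
    { toFun θ := contractBy d θ q
      map_add' θ θ' := by
        rw [← sub_eq_zero, ← forall_dual_apply_eq_zero_iff ℂ]
        simp
      map_smul' c θ := by
        rw [← sub_eq_zero, ← forall_dual_apply_eq_zero_iff ℂ]
        simp }
  have hT : LinearMap.range T = minSubspace q := by
    rw [minSubspace_eq, ← Subspace.dualAnnihilator_inj, Subspace.dualCoannihilator_dualAnnihilator_eq]
    ext v
    rw [Submodule.mem_dualAnnihilator, LinearMap.mem_ker, contract_apply,
      ← forall_dual_apply_eq_zero_iff ℂ]
    simp [T]
  rw [← hT]
  rfl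

theorem exists_linearIndependent_contractBy {q : symPow W d} (hq : k ≤ rk q) :
    ∃ θ : Fin k → Dual ℂ (SymmetricAlgebra ℂ W),
      LinearIndependent ℂ fun j => contractBy d (θ j) q := by
  obtain ⟨f, hf⟩ := exists_linearIndependent_of_le_finrank hq
  have : ∀ j, ∃ θ, contractBy d θ q = f j := fun j => exists_contractBy_iff.2 (f j).2
  choose θ hθ using this
  refine ⟨θ, ?_⟩
  simp only [hθ]
  exact hf.map' (minSubspace q).subtype (Submodule.ker_subtype _)

theorem span_contractBy_le (θ : Fin k → Dual ℂ (SymmetricAlgebra ℂ W)) (q : symPow W d) :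
    Submodule.span ℂ (Set.range fun j => contractBy d (θ j) q) ≤ minSubspace q := by
  rw [Submodule.span_le]
  rintro _ ⟨j, rfl⟩
  exact exists_contractBy_iff.1 ⟨θ j, rfl⟩

theorem le_rk_of_linearIndependent {θ : Fin k → Dual ℂ (SymmetricAlgebra ℂ W)} {q : symPow W d}
    (h : LinearIndependent ℂ fun j => contractBy d (θ j) q) : k ≤ rk q := by
  have := Submodule.finrank_mono (span_contractBy_le θ q)
  rwa [finrank_span_eq_card h, Fintype.card_fin] at this

theorem isOpen_linearIndependent_contractBy (S : Set (symPow W d))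
    (θ : Fin k → Dual ℂ (SymmetricAlgebra ℂ W)) :
    IsOpen {q : S | LinearIndependent ℂ fun j => contractBy d (θ j) (q : symPow W d)} :=
  isOpen_linearIndependent fun j =>
    isRegularMap_of_mem_regMap (linear_mem_regMap (contractBy d (θ j)))

theorem isOpen_le_rk (S : Set (symPow W d)) (r : ℕ) : IsOpen {q : S | r ≤ rk (q : symPow W d)} := by
  rw [isOpen_iff_forall_mem_open]
  intro q hq
  obtain ⟨θ, hθ⟩ := exists_linearIndependent_contractBy hq
  exact ⟨_, fun q' hq' => le_rk_of_linearIndependent hq',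
    isOpen_linearIndependent_contractBy S θ, hθ⟩

theorem eq_of_tensor_eq {x y : SymTaut W d k} (hx : rk x.tensor = k)
    (h : x.tensor = y.tensor) : x = y := by
  have key : ∀ z : SymTaut W d k, rk z.tensor = k → z.space = minSubspace z.tensor := fun z hz =>
    (Submodule.eq_of_le_of_finrank_eq (mem_symPowOf_iff.1 z.tensor_mem)
      (hz.trans z.finrank_space.symm)).symm
  refine SymTaut.ext ?_ h
  rw [key x hx, key y (h ▸ hx), h]

/-- The `k` contractions lie in `L_q`, whose dimension is at most `k` on the cone; if independent
they span it. -/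
theorem exists_framed_section {q : cone W d k}
    {θ : Fin k → Dual ℂ (SymmetricAlgebra ℂ W)}
    (h : LinearIndependent ℂ fun j => contractBy d (θ j) (q : symPow W d)) :
    ((fun j => contractBy d (θ j) (q : symPow W d)), (q : symPow W d)) ∈ framed W d k := by
  refine ⟨h, mem_symPowOf_iff.2 ?_⟩
  obtain ⟨_, x, rfl⟩ := q
  refine (Submodule.eq_of_le_of_finrank_le (span_contractBy_le θ _) ?_).ge
  rw [finrank_span_eq_card h, Fintype.card_fin]
  exact (Submodule.finrank_mono (mem_symPowOf_iff.1 x.tensor_mem)).trans x.finrank_space.le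

/-- The local section of the frame bundle over the locus of tensors of maximal rank which is
defined by `k` contractions. -/
def localSection (θ : Fin k → Dual ℂ (SymmetricAlgebra ℂ W))
    (q : {q : cone W d k | LinearIndependent ℂ fun j => contractBy d (θ j) (q : symPow W d)}) :
    framed W d k :=
  ⟨_, exists_framed_section q.2⟩

/-- The linear map underlying `localSection`. -/
def sectionMap (d : ℕ) (θ : Fin k → Dual ℂ (SymmetricAlgebra ℂ W)) :
    symPow W d →ₗ[ℂ] (Fin k → W) × symPow W d :=
  (LinearMap.pi fun j => contractBy d (θ j)).prod LinearMap.id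

theorem continuous_localSection (θ : Fin k → Dual ℂ (SymmetricAlgebra ℂ W)) :
    Continuous (localSection (d := d) θ) := by
  refine Continuous.subtype_mk ?_ _
  exact (continuous_zariski_of_linear (sectionMap d θ)).comp
    (continuous_subtype_val.comp continuous_subtype_val)

theorem exists_isOpen_section {x : SymTaut W d k} (hx : rk x.tensor = k)
    {V : Set (framed W d k)} (hV : IsOpen V) (hxV : ∀ p, forgetFrame p = x → p ∈ V) :
    ∃ θ : Fin k → Dual ℂ (SymmetricAlgebra ℂ W), ∃ O : Set (cone W d k), IsOpen O ∧
      collapsing W d k x ∈ O ∧ ∀ q ∈ O, rk (q : symPow W d) = k ∧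
        ∃ p ∈ V, sectionMap d θ q = p ∧ collapsing W d k (forgetFrame p) = q := by
  obtain ⟨θ, hθ⟩ := exists_linearIndependent_contractBy hx.ge
  refine ⟨θ, Subtype.val '' (localSection (d := d) θ ⁻¹' V),
    (isOpen_linearIndependent_contractBy _ θ).isOpenMap_subtype_val _
      (hV.preimage (continuous_localSection θ)), ⟨⟨collapsing W d k x, hθ⟩, ?_, rfl⟩, ?_⟩
  · exact hxV _ (eq_of_tensor_eq hx rfl)
  · rintro _ ⟨q, hq, rfl⟩
    refine ⟨le_antisymm ?_ (le_rk_of_linearIndependent q.2), _, hq, rfl, rfl⟩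
    obtain ⟨⟨_, y, rfl⟩, _⟩ := q
    exact (Submodule.finrank_mono (mem_symPowOf_iff.1 y.tensor_mem)).trans y.finrank_space.le

/-- At rank `k` the subspace must be `L_q`, so the map is injective. The local sections `q ↦
(contractions, q)` of the frame bundle are linear, and give both openness and the descent of regular
functions. -/
theorem isIsoOver_rk_eq : IsIsoOver (collapsing W d k) {q | rk (q : symPow W d) = k} := by
  refine ⟨⟨continuous_collapsing.restrictPreimage, ?_, ?_, ?_⟩, ?_⟩
  · intro V hV
    obtain ⟨V', hV', rfl⟩ := isOpen_induced_iff.1 hV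
    rw [isOpen_iff_forall_mem_open]
    rintro _ ⟨x, hx, rfl⟩
    obtain ⟨θ, O, hO, hxO, h⟩ := exists_isOpen_section x.2 (isOpen_symTaut_iff.1 hV')
      (by rintro p hp; rw [Set.mem_preimage, hp]; exact hx)
    refine ⟨Subtype.val ⁻¹' O, ?_, hO.preimage continuous_subtype_val, hxO⟩
    rintro ⟨q, hq⟩ hqO
    obtain ⟨hqk, p, hpV, -, rfl⟩ := h q hqO
    exact ⟨⟨forgetFrame p, hqk⟩, hpV, rfl⟩
  · rintro ⟨x, hx⟩ ⟨y, hy⟩ h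
    exact Subtype.ext (eq_of_tensor_eq hx
      (congrArg (fun z => (z.1 : symPow W d)) h))
  · rintro ⟨⟨_, x, rfl⟩, hx⟩
    exact ⟨⟨x, hx⟩, rfl⟩
  · intro g x hx
    constructor
    · rintro ⟨O, hO, hxO, p, s, h⟩ y rfl
      refine ⟨(collapsing W d k ∘ forgetFrame) ⁻¹' O,
        hO.preimage (continuous_collapsing.comp continuous_forgetFrame), hxO,
        ⟨_, polyFun_comp_linear (LinearMap.snd ℂ (Fin k → W) (symPow W d)) p.2⟩,
        ⟨_, polyFun_comp_linear (LinearMap.snd ℂ (Fin k → W) (symPow W d)) s.2⟩, ?_⟩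
      exact fun y hy => h _ hy
    · intro h
      obtain ⟨p₀, hp₀⟩ := forgetFrame_surjective x
      obtain ⟨θ, hθ⟩ := exists_linearIndependent_contractBy (k := k) (q := x.tensor) hx.ge
      let q₀ : {q : cone W d k | LinearIndependent ℂ fun j => contractBy d (θ j) (q : symPow W d)} :=
        ⟨collapsing W d k x, hθ⟩
      -- A quotient expression on frames pulls back along the linear section to one on the cone.
      obtain ⟨O, hO, hxO, p, s, hps⟩ := h (localSection θ q₀)
        (eq_of_tensor_eq (x := x) (y := forgetFrame (localSection θ q₀)) hx rfl).symm
      refine ⟨Subtype.val '' (localSection (d := d) θ ⁻¹' O),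
        (isOpen_linearIndependent_contractBy _ θ).isOpenMap_subtype_val _
          (hO.preimage (continuous_localSection θ)), ⟨q₀, hxO, rfl⟩,
        ⟨_, polyFun_comp_linear (sectionMap d θ) p.2⟩,
        ⟨_, polyFun_comp_linear (sectionMap d θ) s.2⟩, ?_⟩
      rintro _ ⟨y, hy, rfl⟩
      exact hps _ hy

/-- Take `U` of dimension `k - 1` containing `L_q`, then `w ∉ U` and `w' ∉ U + ℂw`, which exists
because `k < dim W`; the two extensions of `U` differ. -/
theorem exists_ne_of_rk_lt (hk : k < finrank ℂ W) {q : symPow W d} (hq : rk q < k) :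
    ∃ x y : SymTaut W d k, x ≠ y ∧ x.tensor = q ∧ y.tensor = q := by
  obtain ⟨m, rfl⟩ : ∃ m, k = m + 1 := ⟨k - 1, by omega⟩
  obtain ⟨U, hLU, hU⟩ := exists_finrank_eq_of_le (L := minSubspace q) (k := m)
    (Nat.lt_succ_iff.1 hq) (by omega)
  have key : ∀ w ∉ U, finrank ℂ (U ⊔ Submodule.span ℂ {w} : Submodule ℂ W) = m + 1 := fun w hw => by
    rw [Submodule.finrank_sup_span_singleton hw, hU]
  have hne : ∀ U' : Submodule ℂ W, finrank ℂ U' ≤ m + 1 → ∃ w, w ∉ U' := fun U' hU' => by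
    by_contra! h
    rw [(Submodule.eq_top_iff').2 h, finrank_top] at hU'
    omega
  obtain ⟨w, hw⟩ := hne U (by omega)
  obtain ⟨w', hw'⟩ := hne (U ⊔ Submodule.span ℂ {w}) (key w hw).le
  have hw'U : w' ∉ U := fun h => hw' (Submodule.mem_sup_left h)
  refine ⟨⟨_, key w hw, q, mem_symPowOf_iff.2 (hLU.trans le_sup_left)⟩,
    ⟨_, key w' hw'U, q, mem_symPowOf_iff.2 (hLU.trans le_sup_left)⟩, fun h => hw' ?_, rfl, rfl⟩
  have h' : U ⊔ Submodule.span ℂ {w} = U ⊔ Submodule.span ℂ {w'} := congrArg SymTaut.space h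
  rw [h']
  exact Submodule.mem_sup_right (Submodule.mem_span_singleton_self w')

theorem mem_exc_iff (hk : k < finrank ℂ W) {q : cone W d k} :
    q ∈ Exc (collapsing W d k) ↔ rk (q : symPow W d) < k := by
  rw [Exc, Set.mem_compl_iff, ← not_le, not_iff_not]
  constructor
  · rintro ⟨O, ⟨-, hO⟩, hqO⟩
    by_contra! hlt
    obtain ⟨x, y, hxy, hx, hy⟩ := exists_ne_of_rk_lt hk hlt
    have hx' : collapsing W d k x = q := Subtype.ext hx
    have hy' : collapsing W d k y = q := Subtype.ext hy
    have := hO.1.injective (a₁ := ⟨x, by rwa [Set.mem_preimage, hx']⟩)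
      (a₂ := ⟨y, by rwa [Set.mem_preimage, hy']⟩)
      (Subtype.ext (hx'.trans hy'.symm))
    exact hxy (congrArg Subtype.val this)
  · intro h
    -- On the cone the rank never exceeds `k`, so rank `k` is the open condition of rank at least
    -- `k`.
    have heq : {q : cone W d k | rk (q : symPow W d) = k} = {q : cone W d k | k ≤ rk (q : symPow W d)} := by
      ext ⟨_, x, rfl⟩
      refine ⟨fun h => h.ge, fun h => le_antisymm ?_ h⟩
      exact (Submodule.finrank_mono (mem_symPowOf_iff.1 x.tensor_mem)).trans x.finrank_space.le
    refine ⟨_, ⟨?_, isIsoOver_rk_eq⟩, heq ▸ h⟩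
    rw [heq]
    exact isOpen_le_rk _ k

end Collapsing

/-! ### Unipotent shears and their effect on slopes of tensors. -/

section Shear

set_option linter.unusedSectionVars false

variable {W : Type*} [AddCommGroup W] [Module ℂ W] {κ X Y : Type*} [Fintype X] [Fintype Y]
  (b : Basis κ ℂ W) (f : X → κ) (g : Y → κ)

/-- The linear map which adds to each basis vector `b (f x)` the linear combination of the vectors
`b (g y)` with coefficients `c x y`. -/
def shear (c : X → Y → ℂ) : W →ₗ[ℂ] W :=
  LinearMap.id + ∑ x, ∑ y, c x y • (b.coord (f x)).smulRight (b (g y))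

theorem shear_apply (c : X → Y → ℂ) (w : W) :
    shear b f g c w = w + ∑ x, ∑ y, c x y • b.coord (f x) w • b (g y) := by
  simp [shear]

variable {f g}

theorem coord_comp_shear {z : κ} (hz : ∀ y, g y ≠ z) (c : X → Y → ℂ) :
    b.coord z ∘ₗ shear b f g c = b.coord z := by
  ext w
  simp [shear_apply, Finsupp.single_eq_of_ne (hz _).symm]

theorem coord_comp_shear_self (hg : Function.Injective g) (y : Y) (c : X → Y → ℂ) :
    b.coord (g y) ∘ₗ shear b f g c = b.coord (g y) + ∑ x, c x y • b.coord (f x) := by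
  classical
  ext w
  simp [shear_apply, Finsupp.single_apply, hg.eq_iff]

/-- No target index is a source index, so the nilpotent parts multiply to zero and coefficients add.
-/
theorem shear_comp_shear (h : ∀ x y, g y ≠ f x) (c c' : X → Y → ℂ) :
    shear b f g c ∘ₗ shear b f g c' = shear b f g (c + c') := by
  ext w
  have := fun x => LinearMap.congr_fun (coord_comp_shear b (f := f) (h x) c') w
  simp only [LinearMap.comp_apply] at this
  rw [LinearMap.comp_apply, shear_apply b f g c]
  simp only [this]
  simp only [shear_apply, Pi.add_apply, add_smul, Finset.sum_add_distrib]
  abel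

variable (f g) in
@[simp] theorem shear_zero : shear b f g 0 = LinearMap.id := by
  simp [shear]

/-- A shear as a linear automorphism. -/
def shearEquiv (h : ∀ x y, g y ≠ f x) (c : X → Y → ℂ) : W ≃ₗ[ℂ] W :=
  LinearEquiv.ofLinearMap (shear b f g c) (shear b f g (-c))
    (by rw [shear_comp_shear b h]; simp) (by rw [shear_comp_shear b h]; simp)

variable (f) in
/-- The projection to the span of the basis vectors `b (f x)`. -/
def projOn : W →ₗ[ℂ] W := ∑ x, (b.coord (f x)).smulRight (b (f x))

variable (f) in
theorem projOn_apply (w : W) : projOn b f w = ∑ x, b.coord (f x) w • b (f x) := by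
  simp [projOn]

theorem coord_comp_projOn {x : X} (hf : Function.Injective f) :
    b.coord (f x) ∘ₗ projOn b f = b.coord (f x) := by
  classical
  ext w
  simp [projOn_apply, Finsupp.single_apply, hf.eq_iff]

theorem projOn_comp {T : W →ₗ[ℂ] W} (h : ∀ x, b.coord (f x) ∘ₗ T = b.coord (f x)) :
    projOn b f ∘ₗ T = projOn b f := by
  ext w
  have := fun x => LinearMap.congr_fun (h x) w
  simp only [LinearMap.comp_apply] at this
  simp [projOn_apply, -Basis.coord_apply, this]

variable (f) in
/-- The span of the basis vectors `b (f x)`. -/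
def spanOn : Submodule ℂ W := Submodule.span ℂ (Set.range fun x => b (f x))

theorem mem_spanOn_iff {w : W} : w ∈ spanOn b f ↔ ∀ z ∉ Set.range f, b.coord z w = 0 := by
  rw [spanOn, Set.range_comp' b f, Basis.mem_span_image]
  simp only [Set.subset_def, Finset.mem_coe, Finsupp.mem_support_iff, Basis.coord_apply]
  exact forall_congr' fun z => not_imp_comm

variable (f) in
theorem projOn_mem (w : W) : projOn b f w ∈ spanOn b f := by
  rw [projOn_apply]
  exact Submodule.sum_mem _ fun x _ => Submodule.smul_mem _ _ (Submodule.subset_span ⟨x, rfl⟩)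

theorem projOn_eq_self (hf : Function.Injective f) {w : W} (hw : w ∈ spanOn b f) :
    projOn b f w = w := by
  refine b.ext_elem fun z => ?_
  by_cases hz : z ∈ Set.range f
  · obtain ⟨x, rfl⟩ := hz
    exact LinearMap.congr_fun (coord_comp_projOn b hf) w
  · exact ((mem_spanOn_iff b).1 (projOn_mem b f w) z hz).trans ((mem_spanOn_iff b).1 hw z hz).symm

theorem finrank_spanOn (hf : Function.Injective f) : finrank ℂ (spanOn b f) = Fintype.card X :=
  finrank_span_eq_card (b.linearIndependent.comp f hf)

theorem mem_symPowOf_spanOn [Finite κ] {d : ℕ} {q : symPow W d} :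
    q ∈ symPowOf d (spanOn b f) ↔
      ∀ z ∉ Set.range f, symDeriv (b.coord z) (q : SymmetricAlgebra ℂ W) = 0 := by
  have := Fintype.ofFinite κ
  rw [mem_symPowOf_iff_symDeriv]
  constructor
  · intro h z hz
    exact h ((Submodule.mem_dualAnnihilator _).2 fun w hw => (mem_spanOn_iff b).1 hw z hz)
  · intro h v hv
    have hv' : v = ∑ z, v (b z) • b.coord z := by
      refine b.ext fun z => ?_
      simp
    rw [LinearMap.mem_ker, hv', map_sum]
    refine Finset.sum_eq_zero fun z _ => ?_
    rw [map_smul]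
    by_cases hz : z ∈ Set.range f
    · obtain ⟨x, rfl⟩ := hz
      rw [(Submodule.mem_dualAnnihilator _).1 hv _ (Submodule.subset_span ⟨x, rfl⟩), zero_smul]
    · rw [contract_apply, h z hz, smul_zero]

theorem symPowMap_projOn_eq_self (hf : Function.Injective f) {d : ℕ} {q : symPow W d}
    (hq : q ∈ symPowOf d (spanOn b f)) : symPowMap d (projOn b f) q = q :=
  symMap_eq_self (fun _ hw => projOn_eq_self b hf hw) hq

theorem symPowMap_projOn_mem {d : ℕ} (q : symPow W d) :
    symPowMap d (projOn b f) q ∈ symPowOf d (spanOn b f) := by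
  have := symPowMap_mem (g := projOn b f) (symPowOf_top (W := W) (d := d) ▸ Submodule.mem_top (x := q))
  refine symPowOf_mono ?_ this
  rintro _ ⟨w, -, rfl⟩
  exact projOn_mem b f w

theorem shear_mem_spanOn {Z : Type*} [Fintype Z] {e : Z → κ} (hg : Set.range g ⊆ Set.range e)
    (c : X → Y → ℂ) : (spanOn b e).map (shear b f g c) ≤ spanOn b e := by
  rintro _ ⟨w, hw, rfl⟩
  rw [shear_apply]
  refine Submodule.add_mem _ hw (Submodule.sum_mem _ fun x _ => Submodule.sum_mem _ fun y _ =>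
    Submodule.smul_mem _ _ (Submodule.smul_mem _ _ ?_))
  obtain ⟨z, hz⟩ := hg ⟨y, rfl⟩
  rw [← hz]
  exact Submodule.subset_span ⟨z, rfl⟩

theorem symPowMap_shear_mem {Z : Type*} [Fintype Z] {e : Z → κ} (hg : Set.range g ⊆ Set.range e)
    (c : X → Y → ℂ) {d : ℕ} {q : symPow W d} (hq : q ∈ symPowOf d (spanOn b e)) :
    symPowMap d (shear b f g c) q ∈ symPowOf d (spanOn b e) :=
  symPowOf_mono (shear_mem_spanOn b hg c) (symPowMap_mem hq)

variable (f) in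
/-- The functional on symmetric tensors which differentiates along a coordinate, projects to the
symmetric algebra of the span of the `b (f x)`, and applies a linear form `θ`. -/
def slope (θ : Dual ℂ (SymmetricAlgebra ℂ W)) (z : κ) : Dual ℂ (SymmetricAlgebra ℂ W) :=
  θ ∘ₗ (symMap (projOn b f)).toLinearMap ∘ₗ symDeriv (b.coord z)

/-- The projection in the slope absorbs any `T` preserving the coordinates `f x`; only the effect of
`T` on the differentiating coordinate survives. -/
theorem slope_symMap {T : W →ₗ[ℂ] W} (hT : ∀ x, b.coord (f x) ∘ₗ T = b.coord (f x))
    (θ : Dual ℂ (SymmetricAlgebra ℂ W)) (z : κ) (q : SymmetricAlgebra ℂ W) :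
    slope b f θ z (symMap T q) =
      θ (symMap (projOn b f) (contract q (b.coord z ∘ₗ T))) := by
  simp only [slope, LinearMap.comp_apply, AlgHom.toLinearMap_apply, symDeriv_symMap,
    symMap_symMap, projOn_comp b hT, contract_apply]

theorem slope_symMap_of_coord {T : W →ₗ[ℂ] W} (hT : ∀ x, b.coord (f x) ∘ₗ T = b.coord (f x))
    (θ : Dual ℂ (SymmetricAlgebra ℂ W)) {z : κ} (hz : b.coord z ∘ₗ T = b.coord z)
    (q : SymmetricAlgebra ℂ W) : slope b f θ z (symMap T q) = slope b f θ z q := by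
  rw [slope_symMap b hT, hz]
  rfl

theorem slope_shear (h : ∀ x y, g y ≠ f x) (hg : Function.Injective g) (c : X → Y → ℂ)
    (θ : Dual ℂ (SymmetricAlgebra ℂ W)) (y : Y) (q : SymmetricAlgebra ℂ W) :
    slope b f θ (g y) (symMap (shear b f g c) q) =
      slope b f θ (g y) q + ∑ x, c x y * slope b f θ (f x) q := by
  rw [slope_symMap b (fun x => coord_comp_shear b (h x) c), coord_comp_shear_self b hg, map_add,
    map_sum]
  simp [slope]

end Shear

/-! ### Charts of the bundle from sections of the frame bundle. -/

section ChartOfSection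

variable {W : Type u} [AddCommGroup W] [Module ℂ W] {d k : ℕ}

local instance : TopologicalSpace (symPow W d) := zariski _

local instance : TopologicalSpace ((Fin k → W) × symPow W d) := zariski _

/-- By `key`, `φ` inverts the section up to change of frame. Hence the frames over the image of an
open `V` are those in `G` that `φ` sends into `V`, an open condition, and the composite is an open
embedding. -/
theorem hasLinearChart_of_section {E : Type u} [AddCommGroup E] [Module ℂ E]
    [FiniteDimensional ℂ E] {O : Set E} (hO : @IsOpen E (zariski E) O) (σ : O → framed W d k)
    (hσ : IsRegularMap fun o => (σ o : (Fin k → W) × symPow W d))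
    {G : Set ((Fin k → W) × symPow W d)} (hG : IsOpen {p : framed W d k | p.1 ∈ G})
    (φ : G → E) (hφ : IsRegularMap φ)
    (key : ∀ (p : framed W d k) (o : O),
      forgetFrame p = forgetFrame (σ o) ↔ ∃ h : p.1 ∈ G, φ ⟨p.1, h⟩ = o)
    {Z : Set (SymTaut W d k)} {F : Submodule ℂ E} {e c : ℕ}
    (hF : ∀ o : O, forgetFrame (σ o) ∈ Z ↔ (o : E) ∈ F)
    (he : finrank ℂ F = e) (hc : finrank ℂ (E ⧸ F) = c) (o : O) :
    HasLinearChart Z e c (forgetFrame (σ o)) := by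
  let tE : TopologicalSpace E := zariski E
  refine ⟨E, inferInstance, inferInstance, inferInstance, O, fun o => forgetFrame (σ o), F, hO, ?_, ⟨o, rfl⟩, hF, he, hc⟩
  have hcont : Continuous fun o => forgetFrame (σ o) :=
    continuous_forgetFrame.comp (Continuous.subtype_mk hσ.continuous _)
  refine .of_continuous_injective_isOpenMap hcont ?_ ?_
  · intro o₁ o₂ h
    obtain ⟨h₁, h₁'⟩ := (key (σ o₁) o₂).1 h
    obtain ⟨h₂, h₂'⟩ := (key (σ o₁) o₁).1 rfl
    exact Subtype.ext (h₂'.symm.trans h₁')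
  · intro V hV
    obtain ⟨V', hV', rfl⟩ := isOpen_induced_iff.1 hV
    -- Intersecting with `O` is needed because `φ` may take values outside the domain of the
    -- section.
    obtain ⟨T, hT, hTV⟩ := isOpen_induced_iff.1 ((hO.inter hV').preimage hφ.continuous)
    rw [isOpen_symTaut_iff]
    convert hG.inter (hT.preimage continuous_subtype_val) using 1
    ext p
    constructor
    · rintro ⟨o, ho, hop⟩
      obtain ⟨h, h'⟩ := (key p o).1 hop.symm
      have : (⟨p.1, h⟩ : G) ∈ φ ⁻¹' (O ∩ V') := by
        rw [Set.mem_preimage, h']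
        exact ⟨o.2, ho⟩
      rw [← hTV] at this
      exact ⟨h, this⟩
    · rintro ⟨h, h'⟩
      have : (⟨p.1, h⟩ : G) ∈ φ ⁻¹' (O ∩ V') := by
        rw [← hTV]
        exact h'
      exact ⟨⟨_, this.1⟩, this.2, ((key p ⟨_, this.1⟩).2 ⟨h, rfl⟩).symm⟩

end ChartOfSection

/-! ### The chart: a graph, an inner shear and a slice. -/

section Chart

set_option linter.unusedSectionVars false

variable {W : Type u} [AddCommGroup W] [Module ℂ W] {d k : ℕ} {I J H : Type}
  [Fintype I] [Fintype J] [Fintype H] [DecidableEq I] [DecidableEq J]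
  (b : Basis ((I ⊕ J) ⊕ H) ℂ W) (θ : I → Dual ℂ (SymmetricAlgebra ℂ W))

/-- The inclusion of the first block of indices. -/
def blockI (i : I) : (I ⊕ J) ⊕ H := Sum.inl (Sum.inl i)

/-- The inclusion of the second block of indices. -/
def blockJ (j : J) : (I ⊕ J) ⊕ H := Sum.inl (Sum.inr j)

theorem blockI_injective : Function.Injective (blockI : I → (I ⊕ J) ⊕ H) :=
  Sum.inl_injective.comp Sum.inl_injective

theorem blockJ_injective : Function.Injective (blockJ : J → (I ⊕ J) ⊕ H) :=
  Sum.inl_injective.comp Sum.inr_injective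

theorem blockJ_ne_blockI (i : I) (j : J) : (blockJ j : (I ⊕ J) ⊕ H) ≠ blockI i := by
  simp [blockI, blockJ]

theorem inr_ne_inl (x : I ⊕ J) (h : H) : (Sum.inr h : (I ⊕ J) ⊕ H) ≠ Sum.inl x := by simp

/-- The unipotent map moving the span of the first two blocks to a graph over it. -/
abbrev graphShear (a : I ⊕ J → H → ℂ) : W →ₗ[ℂ] W := shear b Sum.inl Sum.inr a

/-- The unipotent map moving the span of the first block inside that of the first two. -/
abbrev innerShear (β : I → J → ℂ) : W →ₗ[ℂ] W := shear b blockI blockJ β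

/-- The slopes of a tensor in the directions of the first block. -/
def slopeI (q : SymmetricAlgebra ℂ W) : Matrix I I ℂ :=
  Matrix.of fun i s => slope b blockI (θ s) (blockI i) q

/-- The slopes of a tensor in the directions of the second block. -/
def slopeJ (q : SymmetricAlgebra ℂ W) : Matrix J I ℂ :=
  Matrix.of fun j s => slope b blockI (θ s) (blockJ j) q

variable {b θ}

theorem slopes_symMap {T : W →ₗ[ℂ] W} (hT : ∀ x, b.coord (Sum.inl x) ∘ₗ T = b.coord (Sum.inl x))
    (q : SymmetricAlgebra ℂ W) :
    slopeI b θ (symMap T q) = slopeI b θ q ∧ slopeJ b θ (symMap T q) = slopeJ b θ q := by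
  constructor <;> ext i s
  · exact slope_symMap_of_coord b (fun x => hT _) _ (hT _) q
  · exact slope_symMap_of_coord b (fun x => hT _) _ (hT _) q

theorem slopes_graphShear (a : I ⊕ J → H → ℂ) (q : SymmetricAlgebra ℂ W) :
    slopeI b θ (symMap (graphShear b a) q) = slopeI b θ q ∧
      slopeJ b θ (symMap (graphShear b a) q) = slopeJ b θ q :=
  slopes_symMap (fun x => coord_comp_shear b (inr_ne_inl x) a) q

theorem slopes_projOn (q : SymmetricAlgebra ℂ W) :
    slopeI b θ (symMap (projOn b Sum.inl) q) = slopeI b θ q ∧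
      slopeJ b θ (symMap (projOn b Sum.inl) q) = slopeJ b θ q :=
  slopes_symMap (fun _ => coord_comp_projOn b Sum.inl_injective) q

theorem slopeI_innerShear (β : I → J → ℂ) (q : SymmetricAlgebra ℂ W) :
    slopeI b θ (symMap (innerShear b β) q) = slopeI b θ q := by
  ext i s
  exact slope_symMap_of_coord b (fun x => coord_comp_shear b (blockJ_ne_blockI x) β) _
    (coord_comp_shear b (blockJ_ne_blockI i) β) q

/-- When `slopeI` is invertible, exactly one `β` brings `slopeJ` to zero; this makes the slice
transverse to the inner shears. -/
theorem slopeJ_innerShear (β : I → J → ℂ) (q : SymmetricAlgebra ℂ W) :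
    slopeJ b θ (symMap (innerShear b β) q) =
      slopeJ b θ q + (Matrix.of β).transpose * slopeI b θ q := by
  ext j s
  simpa only [Matrix.add_apply, Matrix.mul_apply] using!
    slope_shear b blockJ_ne_blockI blockJ_injective β (θ s) j q

variable (b θ) in
/-- The linear slice transverse to the orbits of the inner shears. -/
def slice (d : ℕ) : Submodule ℂ (symPow W d) where
  carrier := {p | p ∈ symPowOf d (spanOn b Sum.inl) ∧ slopeJ b θ (p : SymmetricAlgebra ℂ W) = 0}
  add_mem' := by
    rintro p q ⟨hp, hp'⟩ ⟨hq, hq'⟩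
    refine ⟨Submodule.add_mem _ hp hq, ?_⟩
    ext j s
    have h1 := congrFun (congrFun hp' j) s
    have h2 := congrFun (congrFun hq' j) s
    simp only [slopeJ, Matrix.of_apply, Matrix.zero_apply] at h1 h2 ⊢
    simp [h1, h2]
  zero_mem' := ⟨Submodule.zero_mem _, by ext; simp [slopeJ]⟩
  smul_mem' := by
    rintro c p ⟨hp, hp'⟩
    refine ⟨Submodule.smul_mem _ c hp, ?_⟩
    ext j s
    have h1 := congrFun (congrFun hp' j) s
    simp only [slopeJ, Matrix.of_apply, Matrix.zero_apply] at h1 ⊢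
    simp [h1]

theorem spanOn_blockI_le : spanOn b blockI ≤ spanOn b Sum.inl := by
  refine Submodule.span_mono ?_
  rintro _ ⟨i, rfl⟩
  exact ⟨Sum.inl i, rfl⟩

theorem symPowOf_blockI_le_slice : symPowOf d (spanOn b blockI) ≤ slice b θ d := by
  intro p hp
  refine ⟨symPowOf_mono spanOn_blockI_le hp, ?_⟩
  ext j s
  have := (mem_symPowOf_spanOn b).1 hp (blockJ j) (by rintro ⟨i, hi⟩; exact blockJ_ne_blockI _ _ hi.symm)
  simp [slopeJ, slope, this]

variable (b d) in
/-- The parameter space of a chart: a graph, an inner shear, and a point of the slice. -/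
def ChartSpace (θ : I → Dual ℂ (SymmetricAlgebra ℂ W)) : Type u :=
  (I ⊕ J → H → ℂ) × (I → J → ℂ) × slice b θ d

instance : AddCommGroup (ChartSpace d b θ) :=
  inferInstanceAs (AddCommGroup ((I ⊕ J → H → ℂ) × (I → J → ℂ) × slice b θ d))

instance : Module ℂ (ChartSpace d b θ) :=
  inferInstanceAs (Module ℂ ((I ⊕ J → H → ℂ) × (I → J → ℂ) × slice b θ d))

instance [FiniteDimensional ℂ W] : FiniteDimensional ℂ (ChartSpace d b θ) :=
  inferInstanceAs (Module.Finite ℂ ((I ⊕ J → H → ℂ) × (I → J → ℂ) × slice b θ d))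

/-- The frame attached to a graph. -/
def chartFrame (b : Basis ((I ⊕ J) ⊕ H) ℂ W) (e : Fin k ≃ I ⊕ J) (a : I ⊕ J → H → ℂ) : Fin k → W :=
  fun j => graphShear b a (b (Sum.inl (e j)))

/-- The tensor attached to a point of the parameter space. -/
def chartTensor (o : ChartSpace d b θ) : symPow W d :=
  symPowMap d (graphShear b o.1) (symPowMap d (innerShear b o.2.1) o.2.2)

theorem span_chartFrame (e : Fin k ≃ I ⊕ J) (a : I ⊕ J → H → ℂ) :
    Submodule.span ℂ (Set.range (chartFrame b e a)) =
      (spanOn b Sum.inl).map (graphShear b a) := by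
  rw [spanOn, Submodule.map_span, ← Set.range_comp, ← e.surjective.range_comp]
  rfl

theorem innerShear_mem (β : I → J → ℂ) {p : symPow W d} (hp : p ∈ symPowOf d (spanOn b Sum.inl)) :
    symPowMap d (innerShear b β) p ∈ symPowOf d (spanOn b Sum.inl) :=
  symPowMap_shear_mem b (by rintro _ ⟨j, rfl⟩; exact ⟨Sum.inr j, rfl⟩) β hp

theorem chart_mem_framed (e : Fin k ≃ I ⊕ J) (o : ChartSpace d b θ) :
    (chartFrame b e o.1, chartTensor o) ∈ framed W d k := by
  constructor
  · have h := b.linearIndependent.comp _ (Sum.inl_injective.comp e.injective)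
    exact h.map' (graphShear b o.1)
      (LinearMap.ker_eq_bot.2 (shearEquiv b inr_ne_inl o.1).injective)
  · change chartTensor o ∈ symPowOf d (Submodule.span ℂ (Set.range (chartFrame b e o.1)))
    rw [span_chartFrame]
    exact symPowMap_mem (innerShear_mem _ o.2.2.2.1)

variable (b) in
/-- The coordinates of a frame in the first two blocks. -/
def frameBase (e : Fin k ≃ I ⊕ J) (w : Fin k → W) : Matrix (I ⊕ J) (I ⊕ J) ℂ :=
  Matrix.of fun x y => b.coord (Sum.inl y) (w (e.symm x))

variable (b) in
/-- The coordinates of a frame in the last block. -/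
def frameFibre (e : Fin k ≃ I ⊕ J) (w : Fin k → W) : Matrix (I ⊕ J) H ℂ :=
  Matrix.of fun x h => b.coord (Sum.inr h) (w (e.symm x))

theorem mem_map_graphShear {a : I ⊕ J → H → ℂ} {w : W} :
    w ∈ (spanOn b Sum.inl).map (graphShear b a) ↔
      ∀ h, b.coord (Sum.inr h) w = ∑ x, b.coord (Sum.inl x) w * a x h := by
  have h1 : w ∈ (spanOn b Sum.inl).map (graphShear b a) ↔
      graphShear b (-a) w ∈ spanOn b Sum.inl :=
    Submodule.mem_map_equiv (e := shearEquiv b inr_ne_inl a) _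
  rw [h1, mem_spanOn_iff]
  have h2 : ∀ h, b.coord (Sum.inr h) (graphShear b (-a) w) =
      b.coord (Sum.inr h) w - ∑ x, b.coord (Sum.inl x) w * a x h := by
    intro h
    have := LinearMap.congr_fun (coord_comp_shear_self b (f := Sum.inl) Sum.inr_injective h (-a)) w
    rw [LinearMap.comp_apply] at this
    rw [this]
    simp [sub_eq_add_neg, mul_comm]
  constructor
  · intro h h'
    have := h (Sum.inr h') (by simp)
    rwa [h2, sub_eq_zero] at this
  · rintro h (x | h') hz
    · exact absurd ⟨x, rfl⟩ hz
    · rw [h2, h h', sub_self]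

/-- Both spans have dimension `k`, so equality reduces to each frame vector lying on the graph of
`a`, a matrix equation. -/
theorem forgetFrame_eq_chart_iff (e : Fin k ≃ I ⊕ J) (p : framed W d k) (o : ChartSpace d b θ) :
    forgetFrame p = forgetFrame ⟨_, chart_mem_framed e o⟩ ↔
      frameFibre b e p.1.1 = frameBase b e p.1.1 * Matrix.of o.1 ∧ p.1.2 = chartTensor o := by
  have : Module.Finite ℂ W := Module.Finite.of_basis b
  rw [SymTaut.ext_iff]
  refine and_congr ?_ Iff.rfl
  change Submodule.span ℂ (Set.range p.1.1) = Submodule.span ℂ (Set.range (chartFrame b e o.1)) ↔ _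
  have h1 : Submodule.span ℂ (Set.range p.1.1) = Submodule.span ℂ (Set.range (chartFrame b e o.1)) ↔
      ∀ x, p.1.1 (e.symm x) ∈ Submodule.span ℂ (Set.range (chartFrame b e o.1)) := by
    constructor
    · rintro h x
      rw [← h]
      exact Submodule.subset_span ⟨_, rfl⟩
    · intro h
      refine Submodule.eq_of_le_of_finrank_eq (Submodule.span_le.2 ?_) ?_
      · rintro _ ⟨j, rfl⟩
        simpa using h (e j)
      · rw [finrank_span_eq_card p.2.1, finrank_span_eq_card (chart_mem_framed e o).1]
  rw [h1, ← Matrix.ext_iff]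
  refine forall_congr' fun x => ?_
  rw [span_chartFrame, mem_map_graphShear]
  rfl

/-- A row relation in the base block would also kill the fibre block, giving a linear relation among
the frame vectors. -/
theorem det_frameBase_ne_zero {e : Fin k ≃ I ⊕ J} {w : Fin k → W} (hw : LinearIndependent ℂ w)
    {a : Matrix (I ⊕ J) H ℂ} (h : frameFibre b e w = frameBase b e w * a) :
    (frameBase b e w).det ≠ 0 := by
  intro h0
  obtain ⟨v, hv, hv0⟩ := Matrix.exists_vecMul_eq_zero_iff.2 h0
  have hv' : Matrix.vecMul v (frameFibre b e w) = 0 := by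
    rw [h, ← Matrix.vecMul_vecMul, hv0, Matrix.zero_vecMul]
  have hsum : ∑ x, v x • w (e.symm x) = 0 := by
    refine b.ext_elem fun z => ?_
    rcases z with x | h'
    · simpa [Matrix.vecMul, dotProduct, frameBase] using congrFun hv0 x
    · simpa [Matrix.vecMul, dotProduct, frameFibre] using congrFun hv' h'
  exact hv (funext fun x =>
    Fintype.linearIndependent_iff.1 (hw.comp _ e.symm.injective) v hsum x)

end Chart

/-! ### The inverse of the chart and the rank condition on the slice. -/

section ChartInverse

set_option linter.unusedSectionVars false

variable {W : Type u} [AddCommGroup W] [Module ℂ W] {d k : ℕ} {I J H : Type}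
  [Fintype I] [Fintype J] [Fintype H] [DecidableEq I] [DecidableEq J]
  {b : Basis ((I ⊕ J) ⊕ H) ℂ W} {θ : I → Dual ℂ (SymmetricAlgebra ℂ W)}

/-- Since `slopeJ` vanishes on the slice, `β` is recovered from the tensor as the transpose of
`slopeJ * slopeI⁻¹`. -/
theorem slopes_chartTensor (o : ChartSpace d b θ) :
    slopeI b θ (chartTensor o : SymmetricAlgebra ℂ W) =
        slopeI b θ (o.2.2 : symPow W d) ∧
      slopeJ b θ (chartTensor o : SymmetricAlgebra ℂ W) =
        (Matrix.of o.2.1).transpose * slopeI b θ (o.2.2 : symPow W d) := by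
  simp only [chartTensor, coe_symPowMap, slopes_graphShear, slopeI_innerShear, slopeJ_innerShear,
    o.2.2.2.2, zero_add, and_self]

theorem symPowMap_projOn_graphShear (a : I ⊕ J → H → ℂ) (q : symPow W d) :
    symPowMap d (projOn b Sum.inl) (symPowMap d (graphShear b a) q) =
      symPowMap d (projOn b Sum.inl) q := by
  rw [symPowMap_symPowMap, projOn_comp b fun x => coord_comp_shear b (inr_ne_inl x) a]

theorem symPowMap_innerShear_neg (β : I → J → ℂ) (q : symPow W d) :
    symPowMap d (innerShear b (-β)) (symPowMap d (innerShear b β) q) = q := by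
  rw [symPowMap_symPowMap, shear_comp_shear b blockJ_ne_blockI]
  simp

theorem symPowMap_innerShear_self_neg (β : I → J → ℂ) (q : symPow W d) :
    symPowMap d (innerShear b β) (symPowMap d (innerShear b (-β)) q) = q := by
  rw [symPowMap_symPowMap, shear_comp_shear b blockJ_ne_blockI]
  simp

variable (b θ) in
/-- The framed tensors which lie over the image of the chart. -/
def chartRange (d : ℕ) (e : Fin k ≃ I ⊕ J) : Set ((Fin k → W) × symPow W d) :=
  {p | p ∈ framed W d k ∧ (frameBase b e p.1).det ≠ 0 ∧
    (slopeI b θ (p.2 : SymmetricAlgebra ℂ W)).det ≠ 0}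

variable (b) in
/-- The graph coordinate of a frame. -/
def graphCoord (e : Fin k ≃ I ⊕ J) (w : Fin k → W) : I ⊕ J → H → ℂ :=
  ((frameBase b e w)⁻¹ * frameFibre b e w : Matrix _ _ ℂ)

variable (b θ) in
/-- The inner shear coordinate of a tensor. -/
def innerCoord (q : SymmetricAlgebra ℂ W) : I → J → ℂ :=
  ((slopeJ b θ q * (slopeI b θ q)⁻¹).transpose : Matrix _ _ ℂ)

variable (b θ) in
/-- The slice coordinate of a tensor. -/
def sliceCoord (q : symPow W d) : symPow W d :=
  symPowMap d (innerShear b (-innerCoord b θ q)) (symPowMap d (projOn b Sum.inl) q)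

theorem sliceCoord_mem {q : symPow W d} (hq : (slopeI b θ (q : SymmetricAlgebra ℂ W)).det ≠ 0) :
    sliceCoord b θ q ∈ slice b θ d := by
  refine ⟨innerShear_mem _ (symPowMap_projOn_mem b q), ?_⟩
  rw [sliceCoord, coe_symPowMap, slopeJ_innerShear, coe_symPowMap, (slopes_projOn _).1,
    (slopes_projOn _).2]
  have h : (Matrix.of (-innerCoord b θ (q : SymmetricAlgebra ℂ W))).transpose =
      -(slopeJ b θ (q : SymmetricAlgebra ℂ W) * (slopeI b θ (q : SymmetricAlgebra ℂ W))⁻¹) := by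
    ext i j
    rfl
  rw [h, Matrix.neg_mul, Matrix.mul_assoc, Matrix.nonsing_inv_mul _ (isUnit_iff_ne_zero.2 hq),
    Matrix.mul_one, add_neg_cancel]

/-- The inverse of the chart. -/
def chartInverse (e : Fin k ≃ I ⊕ J) (p : chartRange b θ d e) : ChartSpace d b θ :=
  (graphCoord b e p.1.1, innerCoord b θ (p.1.2 : SymmetricAlgebra ℂ W),
    ⟨sliceCoord b θ p.1.2, sliceCoord_mem p.2.2.2⟩)

theorem chartInverse_eq_iff (e : Fin k ≃ I ⊕ J) (p : framed W d k) {o : ChartSpace d b θ}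
    (ho : (slopeI b θ (o.2.2 : symPow W d)).det ≠ 0) :
    forgetFrame p = forgetFrame ⟨_, chart_mem_framed e o⟩ ↔
      ∃ h : p.1 ∈ chartRange b θ d e, chartInverse e ⟨p.1, h⟩ = o := by
  rw [forgetFrame_eq_chart_iff]
  obtain ⟨⟨w, q⟩, hp⟩ := p
  obtain ⟨a, β, p', hp'⟩ := o
  constructor
  · rintro ⟨hw, hq⟩
    simp only at hw hq ho
    have hdet := det_frameBase_ne_zero hp.1 hw
    have hI : slopeI b θ (q : SymmetricAlgebra ℂ W) = slopeI b θ p' := by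
      rw [hq]
      exact (slopes_chartTensor _).1
    have hJ : slopeJ b θ (q : SymmetricAlgebra ℂ W) = (Matrix.of β).transpose * slopeI b θ p' := by
      rw [hq]
      exact (slopes_chartTensor _).2
    have hβ : innerCoord b θ (q : SymmetricAlgebra ℂ W) = β := by
      rw [innerCoord, hJ, hI, Matrix.mul_assoc, Matrix.mul_nonsing_inv _ (isUnit_iff_ne_zero.2 ho),
        Matrix.mul_one, Matrix.transpose_transpose]
      rfl
    refine ⟨⟨hp, hdet, by rwa [hI]⟩, Prod.ext ?_ (Prod.ext hβ (Subtype.ext ?_))⟩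
    · change ((frameBase b e w)⁻¹ * frameFibre b e w : Matrix _ _ ℂ) = _
      rw [hw, ← Matrix.mul_assoc, Matrix.nonsing_inv_mul _ (isUnit_iff_ne_zero.2 hdet),
        Matrix.one_mul]
      rfl
    · change symPowMap d (innerShear b (-innerCoord b θ (q : SymmetricAlgebra ℂ W)))
        (symPowMap d (projOn b Sum.inl) q) = p'
      have hq' : q = symPowMap d (graphShear b a) (symPowMap d (innerShear b β) p') := hq
      rw [hβ, hq', symPowMap_projOn_graphShear, symPowMap_projOn_eq_self b
        Sum.inl_injective (innerShear_mem _ hp'.1), symPowMap_innerShear_neg]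
  · rintro ⟨⟨hfr, hdet, hI⟩, h⟩
    obtain rfl : graphCoord b e w = a := congrArg Prod.fst h
    obtain rfl : innerCoord b θ (q : SymmetricAlgebra ℂ W) = β :=
      congrArg (Prod.fst ∘ Prod.snd) h
    obtain rfl : sliceCoord b θ q = p' := congrArg (fun o => (o.2.2 : symPow W d)) h
    simp only at hdet hI
    have hw : frameFibre b e w = frameBase b e w * Matrix.of (graphCoord b e w) := by
      change _ = frameBase b e w * ((frameBase b e w)⁻¹ * frameFibre b e w)
      rw [← Matrix.mul_assoc, Matrix.mul_nonsing_inv _ (isUnit_iff_ne_zero.2 hdet), Matrix.one_mul]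
    refine ⟨hw, ?_⟩
    simp only [chartTensor, sliceCoord, symPowMap_innerShear_self_neg]
    rw [symPowMap_symPowMap]
    -- Projecting to the first two blocks and then applying the graph shear is the identity on the
    -- graph, which contains `span w`; hence it fixes `q`.
    refine (symMap_eq_self (L := Submodule.span ℂ (Set.range w)) ?_ hp.2).symm
    intro v hv
    have hv' : v ∈ (spanOn b Sum.inl).map (graphShear b (graphCoord b e w)) := by
      refine Submodule.span_le.2 ?_ hv
      rintro _ ⟨j, rfl⟩
      refine mem_map_graphShear.2 fun h => ?_
      simpa [frameFibre, frameBase, Matrix.mul_apply] using congrFun (congrFun hw (e j)) h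
    obtain ⟨u, hu, rfl⟩ := hv'
    have h1 : projOn b Sum.inl (graphShear b (graphCoord b e w) u) = projOn b Sum.inl u :=
      LinearMap.congr_fun (projOn_comp b fun x => coord_comp_shear b (inr_ne_inl x) _) u
    rw [LinearMap.comp_apply, h1, projOn_eq_self b Sum.inl_injective hu]

theorem linearIndependent_symDeriv_blockI {q : SymmetricAlgebra ℂ W} (h : (slopeI b θ q).det ≠ 0) :
    LinearIndependent ℂ fun i => symDeriv (b.coord (blockI i)) q := by
  let T : SymmetricAlgebra ℂ W →ₗ[ℂ] (I → ℂ) := LinearMap.pi fun s =>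
    θ s ∘ₗ (symMap (projOn b blockI)).toLinearMap
  refine LinearIndependent.of_comp T ?_
  exact Matrix.linearIndependent_rows_iff_isUnit.2
    ((Matrix.isUnit_iff_isUnit_det _).2 (isUnit_iff_ne_zero.2 h))

/-- Shears preserve rank. With `slopeI` invertible, the derivatives along the first block are
independent, so minimal rank puts each derivative along the second block in their span. Its slopes
vanish on the slice, so that derivative is zero. -/
theorem rk_chartTensor_eq_iff {o : ChartSpace d b θ}
    (ho : (slopeI b θ (o.2.2 : symPow W d)).det ≠ 0) :
    rk (chartTensor o) = Fintype.card I ↔ (o.2.2 : symPow W d) ∈ symPowOf d (spanOn b blockI) := by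
  have : Module.Finite ℂ W := Module.Finite.of_basis b
  have h1 : rk (chartTensor o) = rk (o.2.2 : symPow W d) := by
    exact (rk_symPowMap (shearEquiv b inr_ne_inl o.1).injective _).trans
      (rk_symPowMap (shearEquiv b blockJ_ne_blockI o.2.1).injective _)
  obtain ⟨a, β, p, hp⟩ := o
  simp only at h1 ho ⊢
  have hli := linearIndependent_symDeriv_blockI ho
  have hle : Submodule.span ℂ (Set.range fun i => symDeriv (b.coord (blockI i)) p.1) ≤
      LinearMap.range (contract (p : SymmetricAlgebra ℂ W)) := by
    refine Submodule.span_le.2 ?_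
    rintro _ ⟨i, rfl⟩
    exact ⟨_, rfl⟩
  rw [h1]
  constructor
  · intro hr
    rw [rk_eq, ← finrank_span_eq_card hli] at hr
    have heq := Submodule.eq_of_le_of_finrank_eq hle hr.symm
    rw [mem_symPowOf_spanOn]
    rintro ((i | j) | h) hz
    · exact absurd ⟨i, rfl⟩ hz
    · have hj : symDeriv (b.coord (blockJ j)) (p : SymmetricAlgebra ℂ W) ∈
          LinearMap.range (contract (p : SymmetricAlgebra ℂ W)) := ⟨_, rfl⟩
      rw [← heq, Submodule.mem_span_range_iff_exists_fun] at hj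
      obtain ⟨c, hc⟩ := hj
      have hc0 : Matrix.vecMul c (slopeI b θ (p : SymmetricAlgebra ℂ W)) = 0 := by
        ext s
        have h2 := congrFun (congrFun hp.2 j) s
        simp only [slopeJ, Matrix.of_apply, slope, LinearMap.comp_apply, ← hc] at h2
        simpa [Matrix.vecMul, dotProduct, slopeI, slope] using h2
      have hc1 : c = 0 := by
        by_contra hne
        exact ho (Matrix.exists_vecMul_eq_zero_iff.1 ⟨c, hne, hc0⟩)
      change symDeriv (b.coord (blockJ j)) (p : SymmetricAlgebra ℂ W) = 0
      rw [← hc, hc1]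
      simp
    · exact (mem_symPowOf_spanOn b).1 hp.1 _ (by simp)
  · intro hpI
    refine le_antisymm ?_ ?_
    · exact (Submodule.finrank_mono (mem_symPowOf_iff.1 hpI)).trans
        (finrank_spanOn b blockI_injective).le
    · rw [rk_eq, ← finrank_span_eq_card hli]
      exact Submodule.finrank_mono hle

end ChartInverse

/-! ### Regularity of the chart and of its inverse, and dimension counts. -/

section ChartRegular

set_option linter.unusedSectionVars false

theorem finrank_fun_fun (X Y : Type*) [Fintype X] [Fintype Y] :
    finrank ℂ (X → Y → ℂ) = Fintype.card X * Fintype.card Y := by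
  rw [finrank_pi_fintype]
  simp

theorem linear_mem_reg {A : Type*} [AddCommGroup A] [Module ℂ A] {S : Set A} (l : Dual ℂ A) :
    (fun s : S => l s) ∈ reg S :=
  polyFun_mem_reg (linear_mem_polyFun l)

theorem shear_mem_regMap {A W κ X Y : Type*} [AddCommGroup A] [Module ℂ A] {S : Set A}
    [AddCommGroup W] [Module ℂ W] [Fintype X] [Fintype Y] (b : Basis κ ℂ W) (f : X → κ) (g : Y → κ)
    {c : S → X → Y → ℂ} (hc : ∀ x y, (fun s => c s x y) ∈ reg S) (w : W) :
    (fun s => shear b f g (c s) w) ∈ regMap S W := by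
  have : (fun s => shear b f g (c s) w) = (fun _ => w) +
      ∑ x, ∑ y, fun s => c s x y • b.coord (f x) w • b (g y) := by
    ext s
    simp [shear_apply]
  rw [this]
  exact Submodule.add_mem _ (const_mem_regMap w) (Submodule.sum_mem _ fun x _ =>
    Submodule.sum_mem _ fun y _ => smul_const_mem_regMap (hc x y) _)

theorem symMap_shear_mem_regMap {A W κ X Y : Type*} [AddCommGroup A] [Module ℂ A] {S : Set A}
    [AddCommGroup W] [Module ℂ W] [Fintype X] [Fintype Y] (b : Basis κ ℂ W) (f : X → κ) (g : Y → κ)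
    {c : S → X → Y → ℂ} (hc : ∀ x y, (fun s => c s x y) ∈ reg S)
    {q : S → SymmetricAlgebra ℂ W} (hq : q ∈ regMap S (SymmetricAlgebra ℂ W)) :
    (fun s => symMap (shear b f g (c s)) (q s)) ∈ regMap S (SymmetricAlgebra ℂ W) :=
  aeval_mem_regMap (F := fun s => SymmetricAlgebra.ι ℂ W ∘ₗ shear b f g (c s))
    (fun w => linear_comp_mem_regMap (SymmetricAlgebra.ι ℂ W) (shear_mem_regMap b f g hc w)) hq

variable {W : Type u} [AddCommGroup W] [Module ℂ W] [FiniteDimensional ℂ W] {d k : ℕ}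
  {I J H : Type} [Fintype I] [Fintype J] [Fintype H] [DecidableEq I] [DecidableEq J]
  {b : Basis ((I ⊕ J) ⊕ H) ℂ W} {θ : I → Dual ℂ (SymmetricAlgebra ℂ W)}

local instance : TopologicalSpace (symPow W d) := zariski _

local instance : TopologicalSpace ((Fin k → W) × symPow W d) := zariski _

variable (W d k) in
/-- The tensor of a framed tensor, as an element of the symmetric algebra. -/
def tensorProj : (Fin k → W) × symPow W d →ₗ[ℂ] SymmetricAlgebra ℂ W where
  toFun p := p.2
  map_add' _ _ := rfl
  map_smul' _ _ := rfl

variable (W d) in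
/-- A vector of a framed tensor. -/
def frameProj (j : Fin k) : (Fin k → W) × symPow W d →ₗ[ℂ] W where
  toFun p := p.1 j
  map_add' _ _ := rfl
  map_smul' _ _ := rfl

variable (b d θ) in
/-- The graph component of a point of the parameter space. -/
def graphProj : ChartSpace d b θ →ₗ[ℂ] I ⊕ J → H → ℂ where
  toFun o := o.1
  map_add' _ _ := rfl
  map_smul' _ _ := rfl

variable (b d θ) in
/-- The inner shear component of a point of the parameter space. -/
def innerProj : ChartSpace d b θ →ₗ[ℂ] I → J → ℂ where
  toFun o := o.2.1
  map_add' _ _ := rfl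
  map_smul' _ _ := rfl

variable (b d θ) in
/-- The slice component of a point of the parameter space. -/
def sliceProj : ChartSpace d b θ →ₗ[ℂ] symPow W d where
  toFun o := o.2.2
  map_add' _ _ := rfl
  map_smul' _ _ := rfl

theorem isRegularMap_chart (e : Fin k ≃ I ⊕ J) (O : Set (ChartSpace d b θ)) :
    IsRegularMap fun o : O =>
      ((chartFrame b e o.1.1, chartTensor o.1) : (Fin k → W) × symPow W d) := by
  have ha : ∀ x h, (fun o : O => o.1.1 x h) ∈ reg O := fun x h =>
    linear_mem_reg (LinearMap.proj h ∘ₗ LinearMap.proj x ∘ₗ graphProj d b θ)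
  have hβ : ∀ i j, (fun o : O => o.1.2.1 i j) ∈ reg O := fun i j =>
    linear_mem_reg (LinearMap.proj j ∘ₗ LinearMap.proj i ∘ₗ innerProj d b θ)
  refine .prodMk (.pi fun j => isRegularMap_of_mem_regMap (shear_mem_regMap b _ _ ha _))
    (.codRestrict (isRegularMap_of_mem_regMap ?_))
  refine symMap_shear_mem_regMap b _ _ ha (symMap_shear_mem_regMap b _ _ hβ ?_)
  exact linear_mem_regMap ((symPow W d).subtype ∘ₗ sliceProj d b θ)

theorem slopeI_mem_reg (S : Set ((Fin k → W) × symPow W d)) (i s : I) :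
    (fun p : S => slopeI b θ (p.1.2 : SymmetricAlgebra ℂ W) i s) ∈ reg S :=
  linear_mem_reg (slope b blockI (θ s) (blockI i) ∘ₗ tensorProj W d k)

theorem slopeJ_mem_reg (S : Set ((Fin k → W) × symPow W d)) (j : J) (s : I) :
    (fun p : S => slopeJ b θ (p.1.2 : SymmetricAlgebra ℂ W) j s) ∈ reg S :=
  linear_mem_reg (slope b blockI (θ s) (blockJ j) ∘ₗ tensorProj W d k)

theorem frameBase_mem_reg (e : Fin k ≃ I ⊕ J) (S : Set ((Fin k → W) × symPow W d)) (x y : I ⊕ J) :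
    (fun p : S => frameBase b e p.1.1 x y) ∈ reg S :=
  linear_mem_reg (b.coord (Sum.inl y) ∘ₗ frameProj W d (e.symm x))

theorem frameFibre_mem_reg (e : Fin k ≃ I ⊕ J) (S : Set ((Fin k → W) × symPow W d)) (x : I ⊕ J)
    (h : H) : (fun p : S => frameFibre b e p.1.1 x h) ∈ reg S :=
  linear_mem_reg (b.coord (Sum.inr h) ∘ₗ frameProj W d (e.symm x))

theorem isRegularMap_chartInverse (e : Fin k ≃ I ⊕ J) :
    IsRegularMap (chartInverse (b := b) (θ := θ) (d := d) e) := by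
  have hβ : ∀ i j, (fun p : chartRange b θ d e =>
      innerCoord b θ (p.1.2 : SymmetricAlgebra ℂ W) i j) ∈ reg _ := fun i j =>
    mul_matrix_mem_reg (slopeJ_mem_reg _) (inv_matrix_mem_reg (slopeI_mem_reg _)
      fun p => p.2.2.2) j i
  refine .prodMk (.pi fun x => .pi fun h => ?_) (.prodMk (.pi fun i => .pi fun j => ?_)
    (.codRestrict (.codRestrict (isRegularMap_of_mem_regMap ?_))))
  · intro l
    have hl := mul_matrix_mem_reg (inv_matrix_mem_reg (frameBase_mem_reg (b := b) e _)
      fun p => p.2.2.1) (frameFibre_mem_reg (b := b) e _) x h (S := chartRange b θ d e)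
    -- A functional on `ℂ` is multiplication by `l 1`.
    convert Subalgebra.smul_mem _ hl (l 1) using 1
    ext p
    simpa [mul_comm] using! l.map_smul (graphCoord b e p.1.1 x h) 1
  · intro l
    convert Subalgebra.smul_mem _ (hβ i j) (l 1) using 1
    ext p
    simpa [mul_comm] using l.map_smul (innerCoord b θ (p.1.2 : SymmetricAlgebra ℂ W) i j) 1
  · refine symMap_shear_mem_regMap b _ _ (fun i j => Subalgebra.neg_mem _ (hβ i j)) ?_
    exact linear_mem_regMap ((symMap (projOn b Sum.inl)).toLinearMap ∘ₗ tensorProj W d k)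

theorem isOpen_chartRange (e : Fin k ≃ I ⊕ J) :
    IsOpen {p : framed W d k | p.1 ∈ chartRange b θ d e} := by
  have h := (isOpen_ne_reg (det_mem_subalgebra _ (frameBase_mem_reg (b := b) e (framed W d k)))).inter
    (isOpen_ne_reg (det_mem_subalgebra _ (slopeI_mem_reg (b := b) (θ := θ) (framed W d k))))
  convert h using 1
  ext p
  exact ⟨fun h => h.2, fun h => ⟨p.2, h⟩⟩

theorem isOpen_chartDomain : @IsOpen (ChartSpace d b θ) (zariski _)
    {o | (slopeI b θ (o.2.2 : symPow W d)).det ≠ 0} := by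
  refine isOpen_ne_polyFun (det_mem_subalgebra (polyFun _) fun i s => ?_)
  exact linear_mem_polyFun (slope b blockI (θ s) (blockI i) ∘ₗ (symPow W d).subtype ∘ₗ sliceProj d b θ)

/-- The linear subspace of the parameter space which parametrizes tensors of minimal rank. -/
def chartStratum (d : ℕ) (b : Basis ((I ⊕ J) ⊕ H) ℂ W)
    (θ : I → Dual ℂ (SymmetricAlgebra ℂ W)) : Submodule ℂ (ChartSpace d b θ) :=
  (symPowOf d (spanOn b blockI)).comap (sliceProj d b θ)

/-- The `|I||J|` slope equations are independent: inner shears of `p` realise every value of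
`slopeJ`. -/
theorem finrank_slice {p : symPow W d} (hp : p ∈ symPowOf d (spanOn b blockI))
    (h0 : (slopeI b θ (p : SymmetricAlgebra ℂ W)).det ≠ 0) :
    finrank ℂ (slice b θ d) + Fintype.card I * Fintype.card J =
      (Fintype.card I + Fintype.card J + d - 1).choose d := by
  let T : symPowOf d (spanOn b Sum.inl) →ₗ[ℂ] (J → I → ℂ) :=
    LinearMap.pi fun j => LinearMap.pi fun s => slope b blockI (θ s) (blockJ j) ∘ₗ
      (symPow W d).subtype ∘ₗ (symPowOf d (spanOn b Sum.inl)).subtype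
  have hT : ∀ q, Matrix.of (T q) = slopeJ b θ (q.1 : SymmetricAlgebra ℂ W) := fun q => rfl
  have hker : (LinearMap.ker T).map (symPowOf d (spanOn b Sum.inl)).subtype = slice b θ d := by
    ext q
    constructor
    · rintro ⟨q, hq, rfl⟩
      exact ⟨q.2, hq⟩
    · rintro ⟨hq, hq'⟩
      exact ⟨⟨q, hq⟩, hq', rfl⟩
  have hsurj : LinearMap.range T = ⊤ := by
    rw [LinearMap.range_eq_top]
    intro C
    let β : I → J → ℂ := fun i j =>
      (Matrix.of C * (slopeI b θ (p : SymmetricAlgebra ℂ W))⁻¹ : Matrix J I ℂ) j i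
    refine ⟨⟨symPowMap d (innerShear b β) p,
      innerShear_mem _ (symPowOf_mono spanOn_blockI_le hp)⟩, Matrix.of.injective ?_⟩
    rw [hT, coe_symPowMap, slopeJ_innerShear, (symPowOf_blockI_le_slice hp).2, zero_add]
    have hβ : (Matrix.of β).transpose =
        Matrix.of C * (slopeI b θ (p : SymmetricAlgebra ℂ W))⁻¹ := rfl
    rw [hβ, Matrix.mul_assoc, Matrix.nonsing_inv_mul _ (isUnit_iff_ne_zero.2 h0), Matrix.mul_one]
  have h := LinearMap.finrank_range_add_finrank_ker (K := ℂ) (V := symPowOf d (spanOn b Sum.inl))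
    (V₂ := J → I → ℂ) T
  rw [hsurj, finrank_top, finrank_symPowOf, finrank_spanOn b Sum.inl_injective, Fintype.card_sum,
    finrank_fun_fun] at h
  rw [← hker, Submodule.finrank_map_subtype_eq, ← h]
  ring

/-- Used with the symmetric power of the first block for the stratum, and with the slice itself for
the whole parameter space. -/
theorem finrank_comap_sliceProj {S : Submodule ℂ (symPow W d)} (hS : S ≤ slice b θ d) :
    finrank ℂ (S.comap (sliceProj d b θ)) =
      (Fintype.card I + Fintype.card J) * Fintype.card H + Fintype.card I * Fintype.card J +
        finrank ℂ S := by
  let T : S.comap (sliceProj d b θ) →ₗ[ℂ] S := (sliceProj d b θ).restrict fun _ h => h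
  have hrange : LinearMap.range T = ⊤ := by
    rw [LinearMap.range_eq_top]
    rintro ⟨q, hq⟩
    exact ⟨⟨((0, 0, ⟨q, hS hq⟩) : (I ⊕ J → H → ℂ) × (I → J → ℂ) × slice b θ d), hq⟩, rfl⟩
  let F : ((I ⊕ J → H → ℂ) × (I → J → ℂ)) →ₗ[ℂ] S.comap (sliceProj d b θ) :=
    { toFun := fun x => ⟨((x.1, x.2, 0) : (I ⊕ J → H → ℂ) × (I → J → ℂ) × slice b θ d),
        Submodule.zero_mem S⟩
      map_add' := fun x y => Subtype.ext (Prod.ext rfl (Prod.ext rfl (add_zero _).symm))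
      map_smul' := fun c x => Subtype.ext (Prod.ext rfl (Prod.ext rfl (smul_zero _).symm)) }
  have hF : Function.Injective F := fun x y h =>
    Prod.ext (congrArg (fun o => o.1.1) h) (congrArg (fun o => o.1.2.1) h)
  have hker : LinearMap.ker T = LinearMap.range F := by
    ext o
    constructor
    · intro h
      exact ⟨(o.1.1, o.1.2.1), Subtype.ext (Prod.ext rfl (Prod.ext rfl
        (Subtype.ext (congrArg Subtype.val h).symm)))⟩
    · rintro ⟨x, rfl⟩
      rfl
  have h := LinearMap.finrank_range_add_finrank_ker (K := ℂ) (V := S.comap (sliceProj d b θ))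
    (V₂ := S) T
  rw [hrange, finrank_top, hker, LinearMap.finrank_range_of_inj hF, finrank_prod,
    finrank_fun_fun, finrank_fun_fun, Fintype.card_sum] at h
  rw [← h]
  ring

theorem finrank_chartStratum : finrank ℂ (chartStratum d b θ) =
    (Fintype.card I + Fintype.card J) * Fintype.card H + Fintype.card I * Fintype.card J +
      (Fintype.card I + d - 1).choose d := by
  rw [chartStratum, finrank_comap_sliceProj symPowOf_blockI_le_slice, finrank_symPowOf,
    finrank_spanOn b blockI_injective]

theorem finrank_chartSpace {p : symPow W d} (hp : p ∈ symPowOf d (spanOn b blockI))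
    (h0 : (slopeI b θ (p : SymmetricAlgebra ℂ W)).det ≠ 0) :
    finrank ℂ (ChartSpace d b θ) = (Fintype.card I + Fintype.card J) * Fintype.card H +
      (Fintype.card I + Fintype.card J + d - 1).choose d := by
  have h : (slice b θ d).comap (sliceProj d b θ) = ⊤ := by
    rw [eq_top_iff]
    exact fun o _ => o.2.2.2
  rw [← finrank_slice hp h0, ← finrank_top, ← h, finrank_comap_sliceProj le_rfl]
  ring

theorem hasLinearChart_of_basis (e : Fin k ≃ I ⊕ J) {p : symPow W d}
    (hp : p ∈ symPowOf d (spanOn b blockI))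
    (h0 : (slopeI b θ (p : SymmetricAlgebra ℂ W)).det ≠ 0) (x : SymTaut W d k)
    (hx : x.space = spanOn b Sum.inl) (hxp : x.tensor = p) :
    HasLinearChart {x : SymTaut W d k | rk x.tensor = Fintype.card I}
      ((Fintype.card I + Fintype.card J) * Fintype.card H + Fintype.card I * Fintype.card J +
        (Fintype.card I + d - 1).choose d)
      ((Fintype.card I + Fintype.card J + d - 1).choose d -
        (Fintype.card I * Fintype.card J + (Fintype.card I + d - 1).choose d)) x := by
  -- With both shears trivial, the chart sends this parameter to `x`.
  let o : ChartSpace d b θ := (0, 0, ⟨p, symPowOf_blockI_le_slice hp⟩)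
  have hquot : finrank ℂ (ChartSpace d b θ ⧸ chartStratum d b θ) =
      (Fintype.card I + Fintype.card J + d - 1).choose d -
        (Fintype.card I * Fintype.card J + (Fintype.card I + d - 1).choose d) := by
    have := (chartStratum d b θ).finrank_quotient_add_finrank
    rw [finrank_chartSpace hp h0, finrank_chartStratum] at this
    omega
  have h := hasLinearChart_of_section (k := k)
    (Z := {x : SymTaut W d k | rk x.tensor = Fintype.card I})
    (O := {o : ChartSpace d b θ | (slopeI b θ (o.2.2 : symPow W d)).det ≠ 0})
    isOpen_chartDomain (fun o => ⟨_, chart_mem_framed e o.1⟩) (isRegularMap_chart e _)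
    (isOpen_chartRange e) (chartInverse e) (isRegularMap_chartInverse e)
    (fun p o => chartInverse_eq_iff e p o.2) (F := chartStratum d b θ)
    (fun o => rk_chartTensor_eq_iff o.2)
    finrank_chartStratum hquot ⟨o, h0⟩
  convert h
  refine SymTaut.ext ?_ ?_
  · change x.space = Submodule.span ℂ (Set.range (chartFrame b e o.1))
    rw [span_chartFrame, hx]
    simp [o, graphShear]
  · change x.tensor = chartTensor o
    simp [chartTensor, o, graphShear, innerShear, hxp]

end ChartRegular

/-! ### Bases adapted to a flag. -/

section AdaptedBasis

variable {W : Type u} [AddCommGroup W] [Module ℂ W] [FiniteDimensional ℂ W]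

theorem exists_linearIndependent_span_eq (L : Submodule ℂ W) {r : ℕ} (hr : finrank ℂ L = r) :
    ∃ v : Fin r → W, LinearIndependent ℂ v ∧ Submodule.span ℂ (Set.range v) = L := by
  let b := finBasisOfFinrankEq ℂ L hr
  have hli : LinearIndependent ℂ fun i => (b i : W) :=
    b.linearIndependent.map' L.subtype L.ker_subtype
  refine ⟨_, hli, Submodule.eq_of_le_of_finrank_eq (Submodule.span_le.2 ?_) ?_⟩
  · rintro _ ⟨i, rfl⟩
    exact (b i).2
  · rw [finrank_span_eq_card hli, hr, Fintype.card_fin]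

theorem exists_extend_linearIndependent {ι : Type*} [Finite ι] {v : ι → W}
    (hv : LinearIndependent ℂ v) {U : Submodule ℂ W} (hU : Submodule.span ℂ (Set.range v) ≤ U)
    {s : ℕ} (hs : finrank ℂ U = Nat.card ι + s) :
    ∃ w : Fin s → W, LinearIndependent ℂ (Sum.elim v w) ∧
      Submodule.span ℂ (Set.range (Sum.elim v w)) = U := by
  have := Fintype.ofFinite ι
  obtain ⟨C, hC⟩ := Submodule.exists_isCompl (Submodule.span ℂ (Set.range v))
  have hsup : Submodule.span ℂ (Set.range v) ⊔ C ⊓ U = U := by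
    rw [← sup_inf_assoc_of_le C hU, hC.sup_eq_top, top_inf_eq]
  have hdisj : Disjoint (Submodule.span ℂ (Set.range v)) (C ⊓ U) := hC.disjoint.mono_right inf_le_left
  have hfin : finrank ℂ ↥(C ⊓ U) = s := by
    have := Submodule.finrank_sup_add_finrank_inf_eq (Submodule.span ℂ (Set.range v)) (C ⊓ U)
    rw [hsup, hdisj.eq_bot, finrank_bot, finrank_span_eq_card hv, hs, Nat.card_eq_fintype_card] at this
    omega
  obtain ⟨w, hw, hspan⟩ := exists_linearIndependent_span_eq _ hfin
  refine ⟨w, hv.sum_type hw (by rwa [hspan]), ?_⟩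
  rw [Set.Sum.elim_range, Submodule.span_union, hspan, hsup]

theorem exists_basis_of_flag {L U : Submodule ℂ W} (hLU : L ≤ U) {r s t : ℕ}
    (hr : finrank ℂ L = r) (hs : finrank ℂ U = r + s) (ht : finrank ℂ W = r + s + t) :
    ∃ b : Basis ((Fin r ⊕ Fin s) ⊕ Fin t) ℂ W, spanOn b blockI = L ∧ spanOn b Sum.inl = U := by
  obtain ⟨v, hv, rfl⟩ := exists_linearIndependent_span_eq L hr
  obtain ⟨w, hw, rfl⟩ := exists_extend_linearIndependent hv hLU (s := s) (by simpa using hs)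
  obtain ⟨z, hz, hz'⟩ := exists_extend_linearIndependent hw le_top (s := t) (by simpa using ht)
  refine ⟨Basis.mk hz hz'.ge, ?_, ?_⟩
  · simp [spanOn, blockI]
  · simp [spanOn]

end AdaptedBasis

/-! ### Linear charts around every point of a stratum. -/

section LocalChart

variable {W : Type u} [AddCommGroup W] [Module ℂ W] [FiniteDimensional ℂ W] {d k : ℕ}

/-- Choose `θ s` contracting `q` to the basis vector `b (blockI s)` of `L_q`; the slopes are then
the coordinates of these vectors. -/
theorem exists_slopeI_eq_one {I J H : Type} [Fintype I] [Fintype J] [Fintype H] [DecidableEq I]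
    [DecidableEq J] (b : Basis ((I ⊕ J) ⊕ H) ℂ W) {q : symPow W d}
    (hq : minSubspace q = spanOn b blockI) :
    ∃ θ : I → Dual ℂ (SymmetricAlgebra ℂ W), slopeI b θ (q : SymmetricAlgebra ℂ W) = 1 := by
  have h : ∀ s : I, ∃ θ, contractBy d θ q = b (blockI s) := fun s =>
    exists_contractBy_iff.2 (hq ▸ Submodule.subset_span ⟨s, rfl⟩)
  choose θ hθ using h
  refine ⟨θ, ?_⟩
  have hproj : symMap (projOn b blockI) (q : SymmetricAlgebra ℂ W) = q :=
    congrArg Subtype.val (symPowMap_projOn_eq_self b blockI_injective (mem_symPowOf_iff.2 hq.le))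
  classical
  ext i s
  have h1 := symDeriv_symMap (projOn b blockI) (b.coord (blockI i)) (q : SymmetricAlgebra ℂ W)
  rw [hproj, coord_comp_projOn b blockI_injective] at h1
  change θ s (symMap (projOn b blockI) (symDeriv (b.coord (blockI i)) q)) = _
  rw [← h1, ← apply_contractBy, hθ, Basis.coord_apply, Basis.repr_self, Matrix.one_apply,
    Finsupp.single_apply]
  simp [blockI_injective.eq_iff, eq_comm]

theorem exists_chart_data {r : ℕ} (hkW : k ≤ finrank ℂ W) (x : SymTaut W d k)
    (hx : rk x.tensor = r) :
    ∃ (b : Basis ((Fin r ⊕ Fin (k - r)) ⊕ Fin (finrank ℂ W - k)) ℂ W)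
      (θ : Fin r → Dual ℂ (SymmetricAlgebra ℂ W)), x.space = spanOn b Sum.inl ∧
        x.tensor ∈ symPowOf d (spanOn b blockI) ∧
        (slopeI b θ (x.tensor : SymmetricAlgebra ℂ W)).det ≠ 0 := by
  have hLU := mem_symPowOf_iff.1 x.tensor_mem
  have hrk : r ≤ k := by
    exact hx.ge.trans ((Submodule.finrank_mono hLU).trans x.finrank_space.le)
  obtain ⟨b, hL, hU⟩ := exists_basis_of_flag hLU hx (s := k - r) (t := finrank ℂ W - k)
    (by rw [x.finrank_space]; omega) (by omega)
  obtain ⟨θ, hθ⟩ := exists_slopeI_eq_one b hL.symm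
  exact ⟨b, θ, hU.symm, mem_symPowOf_iff.2 hL.ge, by rw [hθ, Matrix.det_one]; exact one_ne_zero⟩

theorem hasLinearChart_rk_eq {r : ℕ} (hrk : r ≤ k) (hkW : k ≤ finrank ℂ W) {x : SymTaut W d k}
    (hx : rk x.tensor = r) :
    HasLinearChart {x : SymTaut W d k | rk x.tensor = r}
      (k * (finrank ℂ W - k) + r * (k - r) + (r + d - 1).choose d)
      ((k + d - 1).choose d - (r * (k - r) + (r + d - 1).choose d)) x := by
  obtain ⟨b, θ, hU, hL, h0⟩ := exists_chart_data hkW x hx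
  have h := hasLinearChart_of_basis
    ((finCongr (Nat.add_sub_cancel' hrk).symm).trans finSumFinEquiv.symm) hL h0 x hU rfl
  simpa only [Fintype.card_fin, Nat.add_sub_cancel' hrk] using h

/-- Ensures that the truncated subtraction in the chart codimension is a true one. -/
theorem stratum_dim_le {r : ℕ} (hrk : r ≤ k) (hkW : k ≤ finrank ℂ W) {x : SymTaut W d k}
    (hx : rk x.tensor = r) : r * (k - r) + (r + d - 1).choose d ≤ (k + d - 1).choose d := by
  obtain ⟨b, θ, hU, hL, h0⟩ := exists_chart_data hkW x hx
  have h := Submodule.finrank_le (chartStratum d b θ)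
  rw [finrank_chartStratum, finrank_chartSpace hL h0] at h
  simp only [Fintype.card_fin, Nat.add_sub_cancel' hrk] at h
  omega

end LocalChart

/-! ### A tensor of full rank in `r` variables. -/

section FermatTensor

variable {W : Type*} [AddCommGroup W] [Module ℂ W]

theorem symDeriv_ι_pow (v : Dual ℂ W) (w : W) (n : ℕ) :
    symDeriv v (SymmetricAlgebra.ι ℂ W w ^ (n + 1)) =
      ((n + 1 : ℂ) * v w) • SymmetricAlgebra.ι ℂ W w ^ n := by
  induction n with
  | zero => simp [Algebra.algebraMap_eq_smul_one]
  | succ n ih =>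
    rw [pow_succ, symDeriv_mul, ih, symDeriv_ι, Algebra.algebraMap_eq_smul_one]
    simp only [mul_smul_comm, mul_one, ← pow_succ', ← add_smul]
    congr 1
    push_cast
    ring

/-- The tensor which is the sum of the `d`-th powers of the standard basis vectors. -/
def fermat (r d : ℕ) : symPow (Fin r → ℂ) d :=
  ∑ i : Fin r, ⟨SymmetricAlgebra.ι ℂ (Fin r → ℂ) (Pi.single i 1) ^ d, Submodule.pow_mem_pow _ (LinearMap.mem_range_self _ _) d⟩

/-- Evaluating `∂_v` of the sum of powers at the `j`-th basis vector gives `d` times the `j`-th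
coefficient of `v`. The other terms vanish because `d - 1 ≥ 1`. -/
theorem rk_fermat (r : ℕ) {d : ℕ} (hd : 2 ≤ d) : rk (fermat r d) = r := by
  obtain ⟨n, rfl⟩ := Nat.exists_eq_add_of_le' hd
  have hinj : Function.Injective (contract (fermat r (n + 2) : SymmetricAlgebra ℂ (Fin r → ℂ))) := by
    rw [injective_iff_map_eq_zero]
    intro v hv
    have h1 : ∀ j, v (Pi.single j 1) = 0 := by
      intro j
      have h2 := congrArg (SymmetricAlgebra.lift (LinearMap.proj (R := ℂ) (φ := fun _ => ℂ) j)) hv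
      simp only [contract_apply, fermat, AddSubmonoidClass.coe_finsetSum, map_sum, symDeriv_ι_pow,
        map_smul, map_pow, SymmetricAlgebra.lift_ι_apply, LinearMap.proj_apply, map_zero] at h2
      rw [Finset.sum_eq_single j] at h2
      · have h3 : ((n + 1 : ℕ) : ℂ) + 1 ≠ 0 := Nat.cast_add_one_ne_zero _
        exact (by simpa using h2 : _ ∨ _).resolve_left h3
      · intro i _ hij
        simp [Pi.single_eq_of_ne hij.symm]
      · simp
    refine LinearMap.pi_ext' fun j => LinearMap.ext_ring ?_
    simpa using h1 j
  rw [rk_eq, LinearMap.finrank_range_of_inj hinj, Subspace.dual_finrank_eq, finrank_fin_fun]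

end FermatTensor

/-! ### Irreducibility of the strata. -/

section Irreducible

set_option linter.unusedSectionVars false

theorem isOpen_of_isOpen_univ {X : Type*} [TopologicalSpace X] {P : X → Prop}
    (h : IsOpen {x : (Set.univ : Set X) | P x}) : IsOpen {x | P x} := by
  convert isOpen_univ.isOpenMap_subtype_val _ h using 1
  ext x
  simp

variable {W : Type u} [AddCommGroup W] [Module ℂ W] [FiniteDimensional ℂ W] {d k r : ℕ} {J : Type}
  [Fintype J]

local instance : TopologicalSpace (symPow W d) := zariski _

local instance : TopologicalSpace (symPow (Fin r → ℂ) d) := zariski _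

local instance : TopologicalSpace ((Fin k → W) × symPow W d) := zariski _

local instance : TopologicalSpace ((Fin r ⊕ J → W) × symPow (Fin r → ℂ) d) := zariski _

variable (W d r J) in
/-- A vector of a pair of a frame and a tensor. -/
def vectorProj (x : Fin r ⊕ J) : (Fin r ⊕ J → W) × symPow (Fin r → ℂ) d →ₗ[ℂ] W where
  toFun p := p.1 x
  map_add' _ _ := rfl
  map_smul' _ _ := rfl

variable (W d r J) in
/-- The tensor of a pair of a frame and a tensor. -/
def stdTensorProj : (Fin r ⊕ J → W) × symPow (Fin r → ℂ) d →ₗ[ℂ] symPow (Fin r → ℂ) d where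
  toFun p := p.2
  map_add' _ _ := rfl
  map_smul' _ _ := rfl

variable (W d r J) in
/-- The pairs of a frame and a tensor of rank `r` in `r` variables. -/
def frameTensors : Set ((Fin r ⊕ J → W) × symPow (Fin r → ℂ) d) :=
  {p | LinearIndependent ℂ p.1 ∧ r ≤ rk p.2}

/-- The linear combinations of the first vectors of a frame. -/
def combination (w : Fin r ⊕ J → W) : (Fin r → ℂ) →ₗ[ℂ] W :=
  Fintype.linearCombination ℂ fun i => w (Sum.inl i)

theorem combination_injective {w : Fin r ⊕ J → W} (hw : LinearIndependent ℂ w) :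
    Function.Injective (combination w) :=
  (hw.comp _ Sum.inl_injective).fintypeLinearCombination_injective

theorem range_combination (w : Fin r ⊕ J → W) :
    LinearMap.range (combination w) = Submodule.span ℂ (Set.range fun i => w (Sum.inl i)) :=
  Fintype.range_linearCombination ℂ _

theorem isOpen_frameTensors : IsOpen (frameTensors W d r J) := by
  refine IsOpen.inter (isOpen_of_isOpen_univ (isOpen_linearIndependent fun x =>
    isRegularMap_of_mem_regMap (linear_mem_regMap (vectorProj W d r J x)))) ?_
  have h : Continuous (stdTensorProj W d r J) := continuous_zariski_of_linear _
  have hr : IsOpen {q : symPow (Fin r → ℂ) d | r ≤ rk q} :=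
    isOpen_of_isOpen_univ (isOpen_le_rk Set.univ r)
  exact hr.preimage h

theorem isPreirreducible_frameTensors : IsPreirreducible (frameTensors W d r J) :=
  (isPreirreducible_of_lines fun _ _ _ _ _ => Set.mem_univ _).open_subset isOpen_frameTensors
    (Set.subset_univ _)

theorem mem_framed_of_mem_frameTensors (e : Fin k ≃ Fin r ⊕ J)
    {p : (Fin r ⊕ J → W) × symPow (Fin r → ℂ) d} (hp : p ∈ frameTensors W d r J) :
    (p.1 ∘ e, symPowMap d (combination p.1) p.2) ∈ framed W d k := by
  refine ⟨hp.1.comp _ e.injective, ?_⟩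
  have h : p.2 ∈ symPowOf d ⊤ := symPowOf_top (W := Fin r → ℂ) (d := d) ▸ Submodule.mem_top
  refine symPowOf_mono ?_ (symPowMap_mem (g := combination p.1) h)
  rw [Submodule.map_top, range_combination]
  refine Submodule.span_mono ?_
  rintro _ ⟨i, rfl⟩
  exact ⟨e.symm (Sum.inl i), by simp⟩

/-- The framed tensor of rank `r` attached to a frame and a tensor in `r` variables. -/
def framedOf (e : Fin k ≃ Fin r ⊕ J) (p : frameTensors W d r J) : framed W d k :=
  ⟨_, mem_framed_of_mem_frameTensors e p.2⟩

theorem isRegularMap_framedOf (e : Fin k ≃ Fin r ⊕ J) :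
    IsRegularMap fun p : frameTensors W d r J =>
      (framedOf e p : (Fin k → W) × symPow W d) := by
  refine .prodMk (.pi fun j =>
    isRegularMap_of_mem_regMap (linear_mem_regMap (vectorProj W d r J (e j))))
    (.codRestrict (isRegularMap_of_mem_regMap ?_))
  refine aeval_mem_regMap
    (F := fun p : frameTensors W d r J => SymmetricAlgebra.ι ℂ W ∘ₗ combination p.1.1) (fun c => ?_)
    (linear_mem_regMap ((symPow (Fin r → ℂ) d).subtype ∘ₗ stdTensorProj W d r J))
  refine linear_comp_mem_regMap (SymmetricAlgebra.ι ℂ W)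
    (f := fun p : frameTensors W d r J => combination p.1.1 c) ?_
  have : (fun p : frameTensors W d r J => combination p.1.1 c) =
      ∑ i, c i • fun p : frameTensors W d r J => vectorProj W d r J (Sum.inl i) p := by
    ext p
    simp [combination, Fintype.linearCombination_apply, vectorProj]
  rw [this]
  exact Submodule.sum_mem _ fun i _ => Submodule.smul_mem _ _ (linear_mem_regMap _)

/-- A basis of `L_q` extends to a basis of `U`, and `q` is then the image of a tensor in `r`
variables of the same rank. -/
theorem range_forgetFrame_framedOf (e : Fin k ≃ Fin r ⊕ J) :
    Set.range (fun p : frameTensors W d r J => forgetFrame (framedOf e p)) =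
      {x : SymTaut W d k | rk x.tensor = r} := by
  ext x
  constructor
  · rintro ⟨p, rfl⟩
    change rk (symPowMap d (combination p.1.1) p.1.2) = r
    rw [rk_symPowMap (combination_injective p.2.1)]
    refine le_antisymm ((Submodule.finrank_le _).trans (finrank_fin_fun ℂ).le) p.2.2
  · intro hx
    have hcard : k = r + Fintype.card J := by simpa using Fintype.card_congr e
    obtain ⟨v, hv, hvL⟩ := exists_linearIndependent_span_eq _ hx
    obtain ⟨w, hw, hwU⟩ := exists_extend_linearIndependent hv
      (hvL.le.trans (mem_symPowOf_iff.1 x.tensor_mem)) (s := Fintype.card J)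
      (by rw [x.finrank_space, Nat.card_fin, hcard])
    let u : Fin r ⊕ J → W := Sum.elim v (w ∘ Fintype.equivFin J)
    have hu : u = Sum.elim v w ∘ Equiv.sumCongr (Equiv.refl _) (Fintype.equivFin J) := by
      ext (i | j) <;> rfl
    have hui : LinearIndependent ℂ u := hu ▸ hw.comp _ (Equiv.injective _)
    have huU : Submodule.span ℂ (Set.range u) = x.space := by
      rw [hu, (Equiv.surjective _).range_comp, hwU]
    have hmem : x.tensor ∈ (symPowOf d ⊤).map (symPowMap d (combination u)) := by
      rw [map_symPowMap, Submodule.map_top, range_combination]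
      exact mem_symPowOf_iff.2 hvL.ge
    obtain ⟨q, -, hq⟩ := hmem
    have hrk : r ≤ rk q := by
      rw [← rk_symPowMap (combination_injective hui) q, hq]
      exact hx.ge
    refine ⟨⟨(u, q), hui, hrk⟩, SymTaut.ext ?_ hq⟩
    change Submodule.span ℂ (Set.range (u ∘ e)) = _
    rw [e.surjective.range_comp, huU]

/-- The parameters form an open subset of a vector space, hence preirreducible; the Fermat tensor
shows that they exist. -/
theorem isIrreducible_rk_eq (hd : 2 ≤ d) (hrk : r ≤ k) (hkW : k ≤ finrank ℂ W) :
    IsIrreducible {x : SymTaut W d k | rk x.tensor = r} := by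
  let e : Fin k ≃ Fin r ⊕ Fin (k - r) :=
    (finCongr (Nat.add_sub_cancel' hrk).symm).trans finSumFinEquiv.symm
  rw [← range_forgetFrame_framedOf e]
  have : PreirreducibleSpace (frameTensors W d r (Fin (k - r))) :=
    Subtype.preirreducibleSpace isPreirreducible_frameTensors
  constructor
  · obtain ⟨f, hf⟩ := exists_linearIndependent_of_le_finrank hkW
    exact ⟨_, ⟨⟨(f ∘ e.symm, fermat r d), hf.comp _ e.symm.injective, (rk_fermat r hd).ge⟩, rfl⟩⟩
  · rw [← Set.image_univ]
    refine PreirreducibleSpace.isPreirreducible_univ.image _ (Continuous.continuousOn ?_)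
    exact continuous_forgetFrame.comp
      (Continuous.subtype_mk (isRegularMap_framedOf e).continuous _)

end Irreducible

/-! ### Assembly: dimensions, codimensions and the exceptional locus. -/

section Main

variable {W : Type u} [AddCommGroup W] [Module ℂ W] [FiniteDimensional ℂ W] {d k r : ℕ}

theorem dim_rk_eq (hd : 2 ≤ d) (hrk : r ≤ k) (hkW : k ≤ finrank ℂ W) :
    topologicalKrullDim {x : SymTaut W d k | rk x.tensor = r} =
      ((k * (finrank ℂ W - k) + r * (k - r) + (r + d - 1).choose d : ℕ) : ℕ∞) :=
  dim_eq_of_hasLinearChart (isIrreducible_rk_eq hd hrk hkW).nonempty fun _ hx =>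
    hasLinearChart_rk_eq hrk hkW hx

theorem exists_codim_rk_eq (hd : 2 ≤ d) (hrk : r ≤ k) (hkW : k ≤ finrank ℂ W) :
    ∃ c : ℕ, codim {x : SymTaut W d k | rk x.tensor = r} = c ∧
      (c : ℤ) = (k + d - 1).choose d - (r + d - 1).choose d - r * (k - r) := by
  have hZ := isIrreducible_rk_eq (W := W) hd hrk hkW
  obtain ⟨x, hx⟩ := hZ.nonempty
  refine ⟨_, codim_eq_of_hasLinearChart hZ hx (hasLinearChart_rk_eq hrk hkW hx), ?_⟩
  rw [Nat.cast_sub (stratum_dim_le hrk hkW hx)]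
  push_cast [Nat.cast_sub hrk]
  ring

theorem preimage_exc (hkW : k < finrank ℂ W) :
    collapsing W d k ⁻¹' Exc (collapsing W d k) =
      ⋃ r : Fin k, {x : SymTaut W d k | rk x.tensor = r} := by
  ext x
  rw [Set.mem_preimage, mem_exc_iff hkW, Set.mem_iUnion]
  exact ⟨fun h => ⟨⟨_, h⟩, rfl⟩, fun ⟨r, hr⟩ => lt_of_eq_of_lt hr r.2⟩

theorem image_exc (hk : 1 ≤ k) (hkW : k < finrank ℂ W) :
    Subtype.val '' Exc (collapsing W d k) = {q : symPow W d | rk q ≤ k - 1} := by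
  ext q
  constructor
  · rintro ⟨q, hq, rfl⟩
    exact Nat.le_sub_one_of_lt ((mem_exc_iff hkW).1 hq)
  · intro hq
    have hlt : rk q < k := Nat.lt_of_le_sub_one hk hq
    have hmem : q ∈ cone W d k := by
      rw [cone_eq hkW.le]
      exact hlt.le
    exact ⟨⟨q, hmem⟩, (mem_exc_iff hkW).2 hlt, rfl⟩

theorem exists_codim_preimage_exc (hd : 2 ≤ d) (hk : 1 ≤ k) (hkW : k < finrank ℂ W) :
    ∃ c : ℕ, codim (collapsing W d k ⁻¹' Exc (collapsing W d k)) = c ∧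
      IsLeast {m : ℤ | ∃ r : ℕ, r < k ∧
        m = (k + d - 1).choose d - (r + d - 1).choose d - r * (k - r)} (c : ℤ) := by
  have : Nonempty (Fin k) := ⟨⟨0, hk⟩⟩
  choose c hc hc' using fun r : Fin k => exists_codim_rk_eq (W := W) hd r.2.le hkW.le
  obtain ⟨r, hr⟩ := Finite.exists_min c
  refine ⟨c r, ?_, ⟨r, r.2, hc' r⟩, ?_⟩
  · rw [preimage_exc hkW, codim_iUnion]
    simp only [hc]
    exact le_antisymm (iInf_le _ r) (le_iInf fun s => Nat.cast_le.2 (hr s))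
  · rintro _ ⟨s, hs, rfl⟩
    rw [← hc' ⟨s, hs⟩]
    exact Nat.cast_le.2 (hr _)

end Main

end Kempf

end

theorem mainTheorem12 {V : Type*} [AddCommGroup V] [Module ℂ V] [FiniteDimensional ℂ V]
    (N d k : ℕ) (hN : Module.finrank ℂ V = N) (hd : 2 ≤ d) (hk : 1 ≤ k) (hkN : k < N) :
    -- the cone is the catalecticant variety
    Kempf.cone (Module.Dual ℂ V) d k = {q | Kempf.rk q ≤ k} ∧
    -- (1)
    Subtype.val '' Kempf.Exc (Kempf.collapsing (Module.Dual ℂ V) d k) =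
      {q : Kempf.symPow (Module.Dual ℂ V) d | Kempf.rk q ≤ k - 1} ∧
    -- (2)
    (∀ r : ℕ, r ≤ k →
      topologicalKrullDim
          (Kempf.collapsing (Module.Dual ℂ V) d k ⁻¹' {q | Kempf.rk q.1 = r}) =
        (((r + d - 1).choose d + r * (N - r) + (k - r) * (N - k) : ℕ) : WithBot ℕ∞) ∧
      ∃ c : ℕ,
        Kempf.codim (Kempf.collapsing (Module.Dual ℂ V) d k ⁻¹' {q | Kempf.rk q.1 = r}) = c ∧
        (c : ℤ) = (k + d - 1).choose d - (r + d - 1).choose d - r * (k - r)) ∧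
    -- (3)
    ∃ c : ℕ,
      Kempf.codim (Kempf.collapsing (Module.Dual ℂ V) d k ⁻¹'
        Kempf.Exc (Kempf.collapsing (Module.Dual ℂ V) d k)) = c ∧
      IsLeast
        {m : ℤ | ∃ r : ℕ, r < k ∧
          m = (k + d - 1).choose d - (r + d - 1).choose d - r * (k - r)}
        (c : ℤ) := by
  subst hN
  have hW : Module.finrank ℂ (Module.Dual ℂ V) = Module.finrank ℂ V := Subspace.dual_finrank_eq
  have hkW : k < Module.finrank ℂ (Module.Dual ℂ V) := hW ▸ hkN
  refine ⟨Kempf.cone_eq hkW.le, Kempf.image_exc hk hkW,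
    fun r hrk => ⟨?_, Kempf.exists_codim_rk_eq hd hrk hkW.le⟩,
    Kempf.exists_codim_preimage_exc hd hk hkW⟩
  refine (Kempf.dim_rk_eq hd hrk hkW.le).trans ?_
  rw [hW]
  congr 2
  -- Writing `k = r + s` and `N = r + s + t` removes the truncated subtractions; the two expressions
  -- agree since `r(N-r) - r(N-k) = r(k-r)`.
  obtain ⟨s, rfl⟩ := Nat.exists_eq_add_of_le hrk
  obtain ⟨t, ht⟩ := Nat.exists_eq_add_of_le hkN.le
  rw [ht]
  have h1 : r + s + t - r = s + t := by omega
  have h2 : r + s + t - (r + s) = t := by omega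
  have h3 : r + s - r = s := by omega
  rw [h1, h2, h3]
  ring
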